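/- Let $m\ge 1$ be an integer, $\epsilon=\pm1$, and let $h_{kl}(u)\in\mathbb C[[u]]$ $(k,l\ge 2)$ be formal power series with $\overline{h_{kl}}=h_{lk}$ (conjugation of the coefficients). The equation $$v=h(z,\bar z,u):=\tfrac12u^m\Bigl(\epsilon|z|^2+\sum_{k,l\ge2}h_{kl}(u)z^k\bar z^l\Bigr),\qquad w=u+iv, \tag{1}$$ is called an admissible equation; it defines a formal real hypersurface in $\mathbb C^2$ through the origin, and a real-analytic one if the series $h$ converges near the origin. The equation (1) is said to be of Fuchsian type if $$\begin{aligned} &\operatorname{ord}h_{22}\ge m-1,\quad \operatorname{ord}h_{23}\ge 2m-2,\quad \operatorname{ord}h_{33}\ge 2m-2,\\ &\operatorname{ord}h_{2l}\ge 2m-l+2\quad(4\le l\le 2m+1),\\ &\operatorname{ord}h_{kl}\ge 2m-k-l+5\quad(k,l\ge3,\ 7\le k+l\le 2m+4), \end{aligned}$$ where $\operatorname{ord}$ is the order of vanishing at $u=0$ $(\operatorname{ord}0=\infty)$. **Theorem.** Being of Fuchsian type does not depend on the choice of formal or holomorphic coordinates in which a hypersurface has the form (1). Precisely, let $v=h(z,\bar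 z,u)$ and $v=h'(z,\bar z,u)$ be two admissible equations, with data $(m,\epsilon,h_{kl})$ and $(m',\epsilon',h'_{kl})$. (a) (Formal coordinates.) Suppose that there are $F,G\in\mathbb C[[z,w]]$ without constant term and with $\det\frac{\partial(F,G)}{\partial(z,w)}(0)\ne0$ such that the formal map $(z,w)\mapsto(F(z,w),G(z,w))$ maps the first formal hypersurface into the second, i.e. $\operatorname{Im}G=h'(F,\bar F,\operatorname{Re}G)$ holds as an identity of formal power series in $z,\bar z,u$ after substituting $w=u+ih(z,\bar z,u)$, $\bar w=u-ih(z,\bar z,u)$. Then the first equation is of Fuchsian type if and only if the second one is. (b) (Holomorphic coordinates.) Suppose that both series converge near the origin, and that a set $M\subset\mathbb C^2$ is given near a point $p$ by the first equation in some local holomorphic coordinates $(z,w)$ of $\mathbb C^2$ centered at $p$, and by the second equation in some other such coordinates. Then the first equation is of Fuchsian type if and only if the second one is. -/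

import Mathlib

open scoped Topology ComplexConjugate

noncomputable section

/-- The data of an admissible equation
`v = (1/2) u^m (ε |z|^2 + ∑_{k,l ≥ 2} h_{kl}(u) z^k \bar z^l)`, with `w = u + i v`, `m ≥ 1` and
`ε = ± 1`. The `h_{kl}` are formal power series in `u`; `h_conj` says that the right-hand side
is real. -/
structure AdmissibleForm where
  m : ℕ
  one_le_m : 1 ≤ m
  ε : ℝ
  ε_eq : ε = 1 ∨ ε = -1
  h : ℕ → ℕ → PowerSeries ℂ
  h_eq_zero : ∀ k l : ℕ, k < 2 ∨ l < 2 → h k l = 0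
  h_conj : ∀ k l : ℕ, PowerSeries.map (starRingEnd ℂ) (h k l) = h l k

namespace AdmissibleForm

/-- The series `∑_{k,l} h_{kl}(u) z^k \bar z^l` in the three independent variables
`z = X 0`, `\bar z = X 1`, `u = X 2`, given by its coefficients. -/
def higherTerms (A : AdmissibleForm) : MvPowerSeries (Fin 3) ℂ :=
  fun n : Fin 3 →₀ ℕ => PowerSeries.coeff (n 2) (A.h (n 0) (n 1))

/-- The right-hand side of the admissible equation as a formal power series in the three
independent variables `z = X 0`, `\bar z = X 1`, `u = X 2`. -/
def definingSeries (A : AdmissibleForm) : MvPowerSeries (Fin 3) ℂ :=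
  MvPowerSeries.C (1 / 2 : ℂ) * MvPowerSeries.X 2 ^ A.m *
    (MvPowerSeries.C (A.ε : ℂ) * MvPowerSeries.X 0 * MvPowerSeries.X 1 +
      A.higherTerms)

/-- Fuchsian type. The subtractions do not truncate in the indicated ranges, and the zero series
has order `⊤`. -/
def IsFuchsian (A : AdmissibleForm) : Prop :=
  ((A.m - 1 : ℕ) : ℕ∞) ≤ (A.h 2 2).order ∧
  ((2 * A.m - 2 : ℕ) : ℕ∞) ≤ (A.h 2 3).order ∧
  ((2 * A.m - 2 : ℕ) : ℕ∞) ≤ (A.h 3 3).order ∧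
  (∀ l : ℕ, 4 ≤ l → l ≤ 2 * A.m + 1 →
    ((2 * A.m + 2 - l : ℕ) : ℕ∞) ≤ (A.h 2 l).order) ∧
  (∀ k l : ℕ, 3 ≤ k → 3 ≤ l → 7 ≤ k + l → k + l ≤ 2 * A.m + 4 →
    ((2 * A.m + 5 - (k + l) : ℕ) : ℕ∞) ≤ (A.h k l).order)

/-- The parametrization `w = u + i h(z, \bar z, u)` of the formal hypersurface. -/
def wSeries (A : AdmissibleForm) : MvPowerSeries (Fin 3) ℂ :=
  MvPowerSeries.X 2 + MvPowerSeries.C Complex.I * A.definingSeries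

/-- The conjugate `\bar w = u - i h(z, \bar z, u)` on the formal hypersurface. -/
def wConjSeries (A : AdmissibleForm) : MvPowerSeries (Fin 3) ℂ :=
  MvPowerSeries.X 2 - MvPowerSeries.C Complex.I * A.definingSeries

/-- The restriction of `F(z, w)` to the formal hypersurface. -/
def pullback (A : AdmissibleForm) (F : MvPowerSeries (Fin 2) ℂ) : MvPowerSeries (Fin 3) ℂ :=
  MvPowerSeries.subst ![MvPowerSeries.X 0, A.wSeries] F

/-- The restriction of the complex conjugate `\bar F(\bar z, \bar w)` of `F(z, w)` to the formal
hypersurface. -/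
def pullbackConj (A : AdmissibleForm) (F : MvPowerSeries (Fin 2) ℂ) : MvPowerSeries (Fin 3) ℂ :=
  MvPowerSeries.subst ![MvPowerSeries.X 1, A.wConjSeries]
    (MvPowerSeries.map (starRingEnd ℂ) F)

end AdmissibleForm

/-- A formal change of coordinates `(z, w) ↦ (F(z, w), G(z, w))` of `ℂ²` at the origin: `F` and `G`
have no constant term and the Jacobian determinant at the origin is nonzero. -/
def IsFormalCoordinateChange (F G : MvPowerSeries (Fin 2) ℂ) : Prop :=
  MvPowerSeries.constantCoeff F = 0 ∧ MvPowerSeries.constantCoeff G = 0 ∧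
  MvPowerSeries.coeff (Finsupp.single 0 1) F * MvPowerSeries.coeff (Finsupp.single 1 1) G -
    MvPowerSeries.coeff (Finsupp.single 1 1) F * MvPowerSeries.coeff (Finsupp.single 0 1) G ≠ 0

/-- `(F, G)` maps the formal hypersurface `A` into `A'`:
`Im G = h'(F, \bar F, Re G)` holds identically on `A`, as formal power series
in `z`, `\bar z`, `u`. -/
def MapsFormally (F G : MvPowerSeries (Fin 2) ℂ) (A A' : AdmissibleForm) : Prop :=
  MvPowerSeries.C (1 / (2 * Complex.I)) * (A.pullback G - A.pullbackConj G) =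
    MvPowerSeries.subst
      ![A.pullback F, A.pullbackConj F,
        MvPowerSeries.C (1 / 2 : ℂ) * (A.pullback G + A.pullbackConj G)]
      A'.definingSeries

/-- `φ = (z, w)` are local holomorphic coordinates of `ℂ²` near `p` in which `p` becomes the origin
and `M` is given, near `p`, by the admissible equation `A`, whose right-hand side converges. -/
def IsAdmissibleCoordinates (M : Set (ℂ × ℂ)) (p : ℂ × ℂ) (φ : ℂ × ℂ → ℂ × ℂ)
    (A : AdmissibleForm) : Prop :=
  AnalyticAt ℂ φ p ∧ φ p = 0 ∧ (fderiv ℂ φ p).IsInvertible ∧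
  ∃ r : ℂ × ℝ → ℝ,
    (∀ᶠ q in 𝓝 (0 : ℂ × ℝ),
      HasSum (fun n : Fin 3 →₀ ℕ =>
        MvPowerSeries.coeff n A.definingSeries *
          q.1 ^ n 0 * (conj q.1) ^ n 1 * (q.2 : ℂ) ^ n 2) (r q : ℂ)) ∧
    ∀ᶠ x in 𝓝 p, (x ∈ M ↔ (φ x).2.im = r ((φ x).1, (φ x).2.re))

end

/-! Write the first equation as v = u^m H / 2, so that w - \bar w = i u^m H on the hypersurface, and
the mapping identity as G - \bar G = i (Re G)^{m'} H'(F, \bar F, Re G). Its lowest terms show that G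
is divisible by w, that c = G_w(0) is real and nonzero, and that a = F_z(0) is nonzero. The
coefficients of z \bar z u^n then give m = m' (`FormalMap.m_eq`).

Fuchsian type is a condition on the support of H: it must lie in `Kset` with N = 2m + 5
(`isFuchsian_iff`). The companion sets `Tset` describe the maps (F, G) to be expected between such
equations. Both families behave well under products and substitutions (`Tset.mul`, `Tset.trans`,
`Kset.mul`, `Kset.trans`), so an induction on the total degree N is possible. Terms of G(0, w) with
real coefficients need no restriction, since they preserve the shape of the equation; only the rest
of G (`restPart`) is constrained.

Suppose both equations and the map are of the expected form up to degree N (`FuchsianUpTo`). The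
first deviations are homogeneous: B and B' of degree N in H and H', f of degree N - 1 in F, g of
degree m + N in G. Modulo admitted exponents the mapping identity reduces to a linear relation
(`FuchsianUpTo.bad_relation`): i c u^m B + g - \bar g = i c^m u^m (ε' (f \bar L + \bar f L) + B'(L,
\bar L, cu)), where L = az + a'u is the linear part of F and f, g are evaluated at (z, u). Monomials
with both exponents of z and \bar z at least 2 see only B and B', so B = 0 if and only if B' = 0.
Once these vanish, the monomials z^k \bar z u^n with k ≥ 2 force f = 0, and then the monomials z^k
u^n force g = 0. Hence if one equation is Fuchsian, the induction runs up to N = 2m + 5 and makes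
the other one Fuchsian.

For holomorphic coordinates, F and G are the Taylor series of the transition map. Asymptotic
expansions can be multiplied and composed (`HasExpansion.mul`, `HasExpansion.comp`) and are unique
on the real points (z, \bar z, u) (`HasExpansion.eq_zero`), so the pointwise identity along the
hypersurface becomes the formal one. -/

noncomputable section

/-! ### Exponents, supports and substitution of formal power series. -/

namespace FuchsianInvariance

open MvPowerSeries

/-- The exponent of `z ^ k * \bar z ^ l * u ^ n`. -/
def e3 (k l n : ℕ) : Fin 3 →₀ ℕ := Finsupp.equivFunOnFinite.symm ![k, l, n]

/-- The exponent of `z ^ k * w ^ j`. -/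
def e2 (k j : ℕ) : Fin 2 →₀ ℕ := Finsupp.equivFunOnFinite.symm ![k, j]

@[simp] theorem e3_zero (k l n : ℕ) : e3 k l n 0 = k := rfl
@[simp] theorem e3_one (k l n : ℕ) : e3 k l n 1 = l := rfl
@[simp] theorem e3_two (k l n : ℕ) : e3 k l n 2 = n := rfl
@[simp] theorem e2_zero (k j : ℕ) : e2 k j 0 = k := rfl
@[simp] theorem e2_one (k j : ℕ) : e2 k j 1 = j := rfl

theorem e3_eta (d : Fin 3 →₀ ℕ) : e3 (d 0) (d 1) (d 2) = d := by
  ext i; fin_cases i <;> rfl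

theorem e2_eta (d : Fin 2 →₀ ℕ) : e2 (d 0) (d 1) = d := by
  ext i; fin_cases i <;> rfl

theorem e3_inj {k l n k' l' n' : ℕ} : e3 k l n = e3 k' l' n' ↔ k = k' ∧ l = l' ∧ n = n' := by
  constructor
  · intro h
    exact ⟨DFunLike.congr_fun h 0, DFunLike.congr_fun h 1, DFunLike.congr_fun h 2⟩
  · rintro ⟨rfl, rfl, rfl⟩; rfl

theorem e2_inj {k j k' j' : ℕ} : e2 k j = e2 k' j' ↔ k = k' ∧ j = j' := by
  constructor
  · intro h
    exact ⟨DFunLike.congr_fun h 0, DFunLike.congr_fun h 1⟩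
  · rintro ⟨rfl, rfl⟩; rfl

theorem e3_add (k l n k' l' n' : ℕ) : e3 k l n + e3 k' l' n' = e3 (k + k') (l + l') (n + n') := by
  ext i; fin_cases i <;> rfl

theorem e3_prod (a : Fin 3 → MvPowerSeries (Fin 3) ℂ) (k l n : ℕ) :
    ((e3 k l n).prod fun s e => a s ^ e) = a 0 ^ k * a 1 ^ l * a 2 ^ n := by
  rw [Finsupp.prod_fintype _ _ (by simp), Fin.prod_univ_three]; rfl

theorem e2_prod (a : Fin 2 → MvPowerSeries (Fin 3) ℂ) (k j : ℕ) :
    ((e2 k j).prod fun s e => a s ^ e) = a 0 ^ k * a 1 ^ j := by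
  rw [Finsupp.prod_fintype _ _ (by simp), Fin.prod_univ_two]; rfl

/-- The power series in `z`, `\bar z`, `u` all of whose monomials have exponents in `S`. -/
def SuppIn (S : ℕ → ℕ → ℕ → Prop) : Submodule ℂ (MvPowerSeries (Fin 3) ℂ) where
  carrier := {f | ∀ k l n, coeff (e3 k l n) f ≠ 0 → S k l n}
  add_mem' := by
    intro f g hf hg k l n h
    by_cases hfk : coeff (e3 k l n) f = 0
    · exact hg k l n fun hgk => h (by rw [map_add, hfk, hgk, add_zero])
    · exact hf k l n hfk
  zero_mem' := by intro k l n h; simp at h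
  smul_mem' := by
    intro c f hf k l n h
    refine hf k l n fun h0 => h ?_
    rw [map_smul, h0, smul_zero]

variable {S S' U : ℕ → ℕ → ℕ → Prop}

theorem coeff_eq_zero_of_mem {f : MvPowerSeries (Fin 3) ℂ} (hf : f ∈ SuppIn S) {k l n : ℕ}
    (h : ¬ S k l n) : coeff (e3 k l n) f = 0 := by
  by_contra h0
  exact h (hf k l n h0)

theorem suppIn_mono {f : MvPowerSeries (Fin 3) ℂ} (hf : f ∈ SuppIn S)
    (h : ∀ k l n, S k l n → S' k l n) : f ∈ SuppIn S' :=
  fun k l n hn => h k l n (hf k l n hn)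

theorem mul_mem_suppIn {f g : MvPowerSeries (Fin 3) ℂ} (hf : f ∈ SuppIn S) (hg : g ∈ SuppIn S')
    (h : ∀ k l n k' l' n', S k l n → S' k' l' n' → U (k + k') (l + l') (n + n')) :
    f * g ∈ SuppIn U := by
  intro k l n hn
  rw [coeff_mul] at hn
  obtain ⟨⟨p, q⟩, hpq, hne⟩ := Finset.exists_ne_zero_of_sum_ne_zero hn
  rw [Finset.HasAntidiagonal.mem_antidiagonal] at hpq
  have h1 : coeff p f ≠ 0 := left_ne_zero_of_mul hne
  have h2 : coeff q g ≠ 0 := right_ne_zero_of_mul hne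
  rw [← e3_eta p] at h1 hpq
  rw [← e3_eta q] at h2 hpq
  have := h _ _ _ _ _ _ (hf _ _ _ h1) (hg _ _ _ h2)
  simp only [e3_add, e3_inj] at hpq
  rwa [hpq.1, hpq.2.1, hpq.2.2] at this

theorem C_mul_mem {f : MvPowerSeries (Fin 3) ℂ} (hf : f ∈ SuppIn S) (c : ℂ) :
    C c * f ∈ SuppIn S := by
  rw [← smul_eq_C_mul]
  exact (SuppIn S).smul_mem c hf

theorem X_zero_eq : (X 0 : MvPowerSeries (Fin 3) ℂ) = monomial (e3 1 0 0) 1 := by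
  rw [X]; congr 2; ext i; fin_cases i <;> simp [e3]

theorem X_one_eq : (X 1 : MvPowerSeries (Fin 3) ℂ) = monomial (e3 0 1 0) 1 := by
  rw [X]; congr 2; ext i; fin_cases i <;> simp [e3]

theorem X_two_eq : (X 2 : MvPowerSeries (Fin 3) ℂ) = monomial (e3 0 0 1) 1 := by
  rw [X]; congr 2; ext i; fin_cases i <;> simp [e3]

theorem X_pow_eq (k l n : ℕ) :
    (X 0 ^ k * X 1 ^ l * X 2 ^ n : MvPowerSeries (Fin 3) ℂ) = monomial (e3 k l n) 1 := by
  simp only [X_zero_eq, X_one_eq, X_two_eq, monomial_pow, monomial_mul_monomial, one_pow, mul_one]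
  congr 2
  ext i; fin_cases i <;> simp [e3]

theorem coeff_X_pow (k l n k' l' n' : ℕ) :
    coeff (e3 k' l' n') (X 0 ^ k * X 1 ^ l * X 2 ^ n : MvPowerSeries (Fin 3) ℂ) =
      if k' = k ∧ l' = l ∧ n' = n then 1 else 0 := by
  classical
  rw [X_pow_eq, coeff_monomial]
  simp only [e3_inj]

theorem X_pow_mem {k l n : ℕ} (h : S k l n) :
    (X 0 ^ k * X 1 ^ l * X 2 ^ n : MvPowerSeries (Fin 3) ℂ) ∈ SuppIn S := by
  intro k' l' n' hn
  rw [coeff_X_pow] at hn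
  split_ifs at hn with h'
  · obtain ⟨rfl, rfl, rfl⟩ := h'; exact h
  · exact absurd rfl hn

theorem X0_mem (h : S 1 0 0) : (X 0 : MvPowerSeries (Fin 3) ℂ) ∈ SuppIn S := by
  simpa using X_pow_mem h

theorem X1_mem (h : S 0 1 0) : (X 1 : MvPowerSeries (Fin 3) ℂ) ∈ SuppIn S := by
  simpa using X_pow_mem h

theorem X2_mem (h : S 0 0 1) : (X 2 : MvPowerSeries (Fin 3) ℂ) ∈ SuppIn S := by
  simpa using X_pow_mem h

theorem X2_pow_mem {n : ℕ} (h : S 0 0 n) : (X 2 ^ n : MvPowerSeries (Fin 3) ℂ) ∈ SuppIn S := by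
  simpa using X_pow_mem h

theorem one_mem_suppIn (h : S 0 0 0) : (1 : MvPowerSeries (Fin 3) ℂ) ∈ SuppIn S := by
  simpa using X_pow_mem h

theorem coeff_X2_pow_mul (f : MvPowerSeries (Fin 3) ℂ) (k l n m : ℕ) :
    coeff (e3 k l (n + m)) (X 2 ^ m * f) = coeff (e3 k l n) f := by
  have h : (X 2 ^ m : MvPowerSeries (Fin 3) ℂ) = monomial (e3 0 0 m) 1 := by
    simpa using X_pow_eq 0 0 m
  have h' : e3 k l (n + m) = e3 0 0 m + e3 k l n := by
    rw [e3_add, e3_inj]; omega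
  rw [h, h', coeff_add_monomial_mul, one_mul]

theorem coeff_X1_mul (f : MvPowerSeries (Fin 3) ℂ) (k l n : ℕ) :
    coeff (e3 k (l + 1) n) (X 1 * f) = coeff (e3 k l n) f := by
  have h' : e3 k (l + 1) n = e3 0 1 0 + e3 k l n := by
    rw [e3_add, e3_inj]; omega
  rw [X_one_eq, h', coeff_add_monomial_mul, one_mul]

/-! ### Substitution -/

theorem hasSubst_of_mem {σ : Type*} [Finite σ] {a : σ → MvPowerSeries (Fin 3) ℂ}
    (ha : ∀ s, a s ∈ SuppIn fun k l n => 1 ≤ k + l + n) : HasSubst a := by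
  refine hasSubst_of_constantCoeff_zero fun s => ?_
  have := coeff_eq_zero_of_mem (ha s) (k := 0) (l := 0) (n := 0) (by simp)
  have h0 : e3 0 0 0 = 0 := by ext i; fin_cases i <;> rfl
  rwa [h0, coeff_zero_eq_constantCoeff_apply] at this

/-- Each coefficient of a substitution is a finite sum over the monomials of `P`, so a constraint on
the support may be checked one monomial at a time. -/
theorem subst_mem {σ : Type*} {a : σ → MvPowerSeries (Fin 3) ℂ} (ha : HasSubst a)
    {P : MvPowerSeries σ ℂ}
    (h : ∀ d, coeff d P ≠ 0 → (d.prod fun s e => a s ^ e) ∈ SuppIn S) :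
    subst a P ∈ SuppIn S := by
  intro k l n hn
  rw [coeff_subst ha] at hn
  obtain ⟨d, hd⟩ : ∃ d, coeff d P • coeff (e3 k l n) (d.prod fun s e => a s ^ e) ≠ 0 := by
    by_contra! h0
    exact hn (by rw [finsum_congr h0, finsum_zero])
  exact h d (left_ne_zero_of_smul hd) k l n (right_ne_zero_of_smul hd)

theorem subst_sub_mem {σ : Type*} {a b : σ → MvPowerSeries (Fin 3) ℂ} (ha : HasSubst a)
    (hb : HasSubst b) {P : MvPowerSeries σ ℂ}
    (h : ∀ d, coeff d P ≠ 0 →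
      (d.prod fun s e => a s ^ e) - (d.prod fun s e => b s ^ e) ∈ SuppIn S) :
    subst a P - subst b P ∈ SuppIn S := by
  intro k l n hn
  rw [map_sub, coeff_subst ha, coeff_subst hb,
    ← finsum_sub_distrib (coeff_subst_finite ha P _) (coeff_subst_finite hb P _)] at hn
  obtain ⟨d, hd⟩ : ∃ d, coeff d P • coeff (e3 k l n) (d.prod fun s e => a s ^ e) -
      coeff d P • coeff (e3 k l n) (d.prod fun s e => b s ^ e) ≠ 0 := by
    by_contra! h0
    exact hn (by rw [finsum_congr h0, finsum_zero])
  rw [← smul_sub, ← map_sub] at hd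
  exact h d (left_ne_zero_of_smul hd) k l n (right_ne_zero_of_smul hd)

theorem subst3_mem {x y t : MvPowerSeries (Fin 3) ℂ} (ha : HasSubst ![x, y, t])
    {P : MvPowerSeries (Fin 3) ℂ}
    (h : ∀ k l n, coeff (e3 k l n) P ≠ 0 → x ^ k * y ^ l * t ^ n ∈ SuppIn S) :
    subst ![x, y, t] P ∈ SuppIn S := by
  refine subst_mem ha fun d hd => ?_
  rw [← e3_eta d] at hd ⊢
  rw [e3_prod]
  exact h _ _ _ hd

theorem subst3_sub_mem {x y t x' y' t' : MvPowerSeries (Fin 3) ℂ} (ha : HasSubst ![x, y, t])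
    (ha' : HasSubst ![x', y', t']) {P : MvPowerSeries (Fin 3) ℂ}
    (h : ∀ k l n, coeff (e3 k l n) P ≠ 0 →
      x ^ k * y ^ l * t ^ n - x' ^ k * y' ^ l * t' ^ n ∈ SuppIn S) :
    subst ![x, y, t] P - subst ![x', y', t'] P ∈ SuppIn S := by
  refine subst_sub_mem ha ha' fun d hd => ?_
  rw [← e3_eta d] at hd ⊢
  rw [e3_prod, e3_prod]
  exact h _ _ _ hd

theorem subst2_mem {x t : MvPowerSeries (Fin 3) ℂ} (ha : HasSubst ![x, t])
    {P : MvPowerSeries (Fin 2) ℂ}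
    (h : ∀ k j, coeff (e2 k j) P ≠ 0 → x ^ k * t ^ j ∈ SuppIn S) :
    subst ![x, t] P ∈ SuppIn S := by
  refine subst_mem ha fun d hd => ?_
  rw [← e2_eta d] at hd ⊢
  rw [e2_prod]
  exact h _ _ hd

theorem subst2_sub_mem {x t x' t' : MvPowerSeries (Fin 3) ℂ} (ha : HasSubst ![x, t])
    (ha' : HasSubst ![x', t']) {P : MvPowerSeries (Fin 2) ℂ}
    (h : ∀ k j, coeff (e2 k j) P ≠ 0 → x ^ k * t ^ j - x' ^ k * t' ^ j ∈ SuppIn S) :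
    subst ![x, t] P - subst ![x', t'] P ∈ SuppIn S := by
  refine subst_sub_mem ha ha' fun d hd => ?_
  rw [← e2_eta d] at hd ⊢
  rw [e2_prod, e2_prod]
  exact h _ _ hd

theorem coeff_subst2_X0_X2 (P : MvPowerSeries (Fin 2) ℂ) (k l n : ℕ) :
    coeff (e3 k l n) (subst ![(X 0 : MvPowerSeries (Fin 3) ℂ), X 2] P) =
      if l = 0 then coeff (e2 k n) P else 0 := by
  rw [coeff_subst HasSubst.X_X, finsum_eq_single _ (e2 k n)]
  · rw [e2_prod]
    have := coeff_X_pow k 0 n k l n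
    simp only [pow_zero, mul_one, true_and, and_true] at this
    simp [this]
  · intro d hd
    rw [← e2_eta d] at hd ⊢
    rw [e2_prod]
    have := coeff_X_pow (d 0) 0 (d 1) k l n
    simp only [pow_zero, mul_one] at this
    rw [Ne, e2_inj] at hd
    simp only [Matrix.cons_val_zero, Matrix.cons_val_one, this]
    rw [if_neg (by omega), smul_zero]

theorem coeff_subst2_X1_X2 (P : MvPowerSeries (Fin 2) ℂ) (k l n : ℕ) :
    coeff (e3 k l n) (subst ![(X 1 : MvPowerSeries (Fin 3) ℂ), X 2] P) =
      if k = 0 then coeff (e2 l n) P else 0 := by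
  rw [coeff_subst HasSubst.X_X, finsum_eq_single _ (e2 l n)]
  · rw [e2_prod]
    have := coeff_X_pow 0 l n k l n
    simp only [pow_zero, one_mul, and_true] at this
    simp [this]
  · intro d hd
    rw [← e2_eta d] at hd ⊢
    rw [e2_prod]
    have := coeff_X_pow 0 (d 0) (d 1) k l n
    simp only [pow_zero, one_mul] at this
    rw [Ne, e2_inj] at hd
    simp only [Matrix.cons_val_zero, Matrix.cons_val_one, this]
    rw [if_neg (by omega), smul_zero]

end FuchsianInvariance

end

/-! ### Stable exponent sets and Fuchsian type as a support condition. -/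

noncomputable section

namespace FuchsianInvariance

open MvPowerSeries

/-- A set of exponents, stable under the operations below, which bounds the bidegree in
`(z, \bar z)` in terms of the total degree: each gain of `m + 1` in the total degree allows one
more power of `z` and of `\bar z`. Everything of total degree `e + N - 2` is admitted. -/
def Tset (m N p q e k l n : ℕ) : Prop :=
  (k ≤ p ∧ l ≤ q ∧ e ≤ k + l + n) ∨
  (k ≤ p + 1 ∧ l ≤ q + 1 ∧ e + m + 1 ≤ k + l + n) ∨
  ((k ≤ p ∨ l ≤ q) ∧ e + m + 2 ≤ k + l + n) ∨
  (k ≤ p + 2 ∧ l ≤ q + 2 ∧ e + 2 * m + 2 ≤ k + l + n) ∨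
  e + N ≤ k + l + n + 2

/-- The exponents that may occur in `u ^ e` times the right-hand side of an equation of Fuchsian
type, up to total degree `e + N`. -/
def Kset (m N e k l n : ℕ) : Prop :=
  Tset m N 1 1 (e + 2) k l n ∨
  ((k ≤ 2 ∨ l ≤ 2) ∧ e + 2 * m + 4 ≤ k + l + n) ∨
  (((k ≤ 2 ∧ l ≤ 3) ∨ (k ≤ 3 ∧ l ≤ 2)) ∧ e + 2 * m + 3 ≤ k + l + n)

/-- Gains of degree add up. Two gains of m + 1 give the fourth clause; a gain of m + 1 and one of m
+ 2 give 2m + 3, which the last clause absorbs precisely when N ≤ 2m + 5. This is the reason for the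
upper bound on N; the bound 2 ≤ N makes the last clause absorb further factors. -/
theorem Tset.mul {m N p q e p' q' e' k l n k' l' n' : ℕ} (h2 : 2 ≤ N) (hN : N ≤ 2 * m + 5)
    (h : Tset m N p q e k l n) (h' : Tset m N p' q' e' k' l' n') :
    Tset m N (p + p') (q + q') (e + e') (k + k') (l + l') (n + n') := by
  unfold Tset at *
  rcases h with h | h | h | h | h <;> rcases h' with h' | h' | h' | h' | h' <;> omega

/-- This is stability under substitution: a monomial with exponents (k, l, n), evaluated at series
that behave like z, \bar z and u, lies in `Tset m N k l (k + l + n)`. -/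
theorem Tset.trans {m N p q e k l n k' l' n' : ℕ} (h2 : 2 ≤ N) (hN : N ≤ 2 * m + 5)
    (h : Tset m N p q e k l n) (h' : Tset m N k l (k + l + n) k' l' n') :
    Tset m N p q e k' l' n' := by
  unfold Tset at *
  rcases h with h | h | h | h | h <;> rcases h' with h' | h' | h' | h' | h' <;> omega

/-- The two extra clauses of `Kset` begin at degree e + 2m + 3, at most two below the ceiling e + N.
As m ≥ 1, every gain of m + 1 or more lifts their monomials to the ceiling, so only the gain-free
clause of `Tset` needs a comparison of bidegrees. -/
theorem Kset.trans {m N e k l n k' l' n' : ℕ} (hm : 1 ≤ m) (h2 : 2 ≤ N) (hN : N ≤ 2 * m + 5)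
    (h : Kset m N e k l n) (h' : Tset m N k l (k + l + n) k' l' n') :
    Kset m N e k' l' n' := by
  rcases h with h | h | h
  · exact Or.inl (h.trans h2 hN h')
  all_goals unfold Kset Tset at *; rcases h' with h' | h' | h' | h' | h' <;> omega

theorem Kset.mul {m N e e' k l n k' l' n' : ℕ} (hm : 1 ≤ m) (h2 : 2 ≤ N) (hN : N ≤ 2 * m + 5)
    (h : Kset m N e k l n) (h' : Tset m N 0 0 e' k' l' n') :
    Kset m N (e + e') (k + k') (l + l') (n + n') := by
  rcases h with h | h | h
  · have := h.mul h2 hN h'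
    rw [show e + 2 + e' = e + e' + 2 by omega] at this
    exact Or.inl this
  all_goals unfold Kset Tset at *; rcases h' with h' | h' | h' | h' | h' <;> omega

theorem mul_mem_T {m N p q e p' q' e' : ℕ} (h2 : 2 ≤ N) (hN : N ≤ 2 * m + 5)
    {f g : MvPowerSeries (Fin 3) ℂ} (hf : f ∈ SuppIn (Tset m N p q e))
    (hg : g ∈ SuppIn (Tset m N p' q' e')) :
    f * g ∈ SuppIn (Tset m N (p + p') (q + q') (e + e')) :=
  mul_mem_suppIn hf hg fun _ _ _ _ _ _ h h' => h.mul h2 hN h'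

theorem mul_mem_K {m N e e' : ℕ} (hm : 1 ≤ m) (h2 : 2 ≤ N) (hN : N ≤ 2 * m + 5)
    {f g : MvPowerSeries (Fin 3) ℂ} (hf : f ∈ SuppIn (Kset m N e))
    (hg : g ∈ SuppIn (Tset m N 0 0 e')) :
    f * g ∈ SuppIn (Kset m N (e + e')) :=
  mul_mem_suppIn hf hg fun _ _ _ _ _ _ h h' => h.mul hm h2 hN h'

theorem pow_mem_T {m N p q e : ℕ} (h2 : 2 ≤ N) (hN : N ≤ 2 * m + 5)
    {f : MvPowerSeries (Fin 3) ℂ} (hf : f ∈ SuppIn (Tset m N p q e)) (k : ℕ) :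
    f ^ k ∈ SuppIn (Tset m N (k * p) (k * q) (k * e)) := by
  induction k with
  | zero => exact one_mem_suppIn (by unfold Tset; omega)
  | succ k ih => simpa only [pow_succ, Nat.succ_mul] using mul_mem_T h2 hN ih hf

theorem monomial_mem_T {m N : ℕ} (h2 : 2 ≤ N) (hN : N ≤ 2 * m + 5)
    {x y t : MvPowerSeries (Fin 3) ℂ} (hx : x ∈ SuppIn (Tset m N 1 0 1))
    (hy : y ∈ SuppIn (Tset m N 0 1 1)) (ht : t ∈ SuppIn (Tset m N 0 0 1)) (k l n : ℕ) :
    x ^ k * y ^ l * t ^ n ∈ SuppIn (Tset m N k l (k + l + n)) := by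
  simpa using mul_mem_T h2 hN (mul_mem_T h2 hN (pow_mem_T h2 hN hx k) (pow_mem_T h2 hN hy l))
    (pow_mem_T h2 hN ht n)

/-! ### Orders of vanishing -/

/-- The exponents of total degree at least `e`. -/
def Dset (e k l n : ℕ) : Prop := e ≤ k + l + n

/-- The exponents whose power of `u` is at least `e`. -/
def Uset (e _k _l n : ℕ) : Prop := e ≤ n

theorem mul_mem_D {e e' : ℕ} {f g : MvPowerSeries (Fin 3) ℂ} (hf : f ∈ SuppIn (Dset e))
    (hg : g ∈ SuppIn (Dset e')) : f * g ∈ SuppIn (Dset (e + e')) :=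
  mul_mem_suppIn hf hg fun _ _ _ _ _ _ h h' => by unfold Dset at *; omega

theorem mul_mem_U {e e' : ℕ} {f g : MvPowerSeries (Fin 3) ℂ} (hf : f ∈ SuppIn (Uset e))
    (hg : g ∈ SuppIn (Uset e')) : f * g ∈ SuppIn (Uset (e + e')) :=
  mul_mem_suppIn hf hg fun _ _ _ _ _ _ h h' => by unfold Uset at *; omega

theorem pow_mem_D {e : ℕ} {f : MvPowerSeries (Fin 3) ℂ} (hf : f ∈ SuppIn (Dset e)) (k : ℕ) :
    f ^ k ∈ SuppIn (Dset (k * e)) := by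
  induction k with
  | zero => exact one_mem_suppIn (by unfold Dset; omega)
  | succ k ih => simpa only [pow_succ, Nat.succ_mul] using mul_mem_D ih hf

theorem pow_mem_U {e : ℕ} {f : MvPowerSeries (Fin 3) ℂ} (hf : f ∈ SuppIn (Uset e)) (k : ℕ) :
    f ^ k ∈ SuppIn (Uset (k * e)) := by
  induction k with
  | zero => exact one_mem_suppIn (by unfold Uset; omega)
  | succ k ih => simpa only [pow_succ, Nat.succ_mul] using mul_mem_U ih hf

theorem mem_D_zero (f : MvPowerSeries (Fin 3) ℂ) : f ∈ SuppIn (Dset 0) :=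
  fun _ _ _ _ => Nat.zero_le _

theorem mem_U_zero (f : MvPowerSeries (Fin 3) ℂ) : f ∈ SuppIn (Uset 0) :=
  fun _ _ _ _ => Nat.zero_le _

theorem mem_D_mono {e e' : ℕ} {f : MvPowerSeries (Fin 3) ℂ} (hf : f ∈ SuppIn (Dset e))
    (h : e' ≤ e) : f ∈ SuppIn (Dset e') :=
  suppIn_mono hf fun _ _ _ h' => h.trans h'

theorem mem_U_mono {e e' : ℕ} {f : MvPowerSeries (Fin 3) ℂ} (hf : f ∈ SuppIn (Uset e))
    (h : e' ≤ e) : f ∈ SuppIn (Uset e') :=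
  suppIn_mono hf fun _ _ _ h' => h.trans h'

/-- If `f ≡ g` up to degree `e + 1` and both have order one, then `f ^ k ≡ g ^ k` up to
degree `e + k`. -/
theorem pow_sub_pow_mem_D {e : ℕ} {f g : MvPowerSeries (Fin 3) ℂ} (hf : f ∈ SuppIn (Dset 1))
    (hg : g ∈ SuppIn (Dset 1)) (h : f - g ∈ SuppIn (Dset (e + 1))) (k : ℕ) :
    f ^ k - g ^ k ∈ SuppIn (Dset (e + k)) := by
  induction k with
  | zero => simp
  | succ k ih =>
    have : f ^ (k + 1) - g ^ (k + 1) = (f ^ k - g ^ k) * f + g ^ k * (f - g) := by ring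
    rw [this]
    refine add_mem (mem_D_mono (mul_mem_D ih hf) (by omega)) ?_
    exact mem_D_mono (mul_mem_D (pow_mem_D hg k) h) (by omega)

/-- Congruence of monomials from congruence of the variables. -/
theorem monomial_sub_mem_D {e : ℕ} {x y t x' y' t' : MvPowerSeries (Fin 3) ℂ}
    (hx : x ∈ SuppIn (Dset 1)) (hx' : x' ∈ SuppIn (Dset 1)) (hxx : x - x' ∈ SuppIn (Dset (e + 1)))
    (hy : y ∈ SuppIn (Dset 1)) (hy' : y' ∈ SuppIn (Dset 1)) (hyy : y - y' ∈ SuppIn (Dset (e + 1)))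
    (ht : t ∈ SuppIn (Dset 1)) (ht' : t' ∈ SuppIn (Dset 1)) (htt : t - t' ∈ SuppIn (Dset (e + 1)))
    (k l n : ℕ) :
    x ^ k * y ^ l * t ^ n - x' ^ k * y' ^ l * t' ^ n ∈ SuppIn (Dset (e + (k + l + n))) := by
  have : x ^ k * y ^ l * t ^ n - x' ^ k * y' ^ l * t' ^ n =
      (x ^ k - x' ^ k) * y ^ l * t ^ n + x' ^ k * (y ^ l - y' ^ l) * t ^ n +
        x' ^ k * y' ^ l * (t ^ n - t' ^ n) := by ring
  rw [this]
  have hxk := pow_sub_pow_mem_D hx hx' hxx k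
  have hyk := pow_sub_pow_mem_D hy hy' hyy l
  have htk := pow_sub_pow_mem_D ht ht' htt n
  refine add_mem (add_mem ?_ ?_) ?_
  · exact mem_D_mono (mul_mem_D (mul_mem_D hxk (pow_mem_D hy l)) (pow_mem_D ht n)) (by omega)
  · exact mem_D_mono (mul_mem_D (mul_mem_D (pow_mem_D hx' k) hyk) (pow_mem_D ht n)) (by omega)
  · exact mem_D_mono (mul_mem_D (mul_mem_D (pow_mem_D hx' k) (pow_mem_D hy' l)) htk) (by omega)

/-! ### Admissible equations -/

/-- The series `H` for which the admissible equation is `v = u ^ m / 2 * H`. -/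
def reducedSeries (A : AdmissibleForm) : MvPowerSeries (Fin 3) ℂ :=
  C (A.ε : ℂ) * X 0 * X 1 + A.higherTerms

theorem coeff_higherTerms (A : AdmissibleForm) (k l n : ℕ) :
    coeff (e3 k l n) A.higherTerms = PowerSeries.coeff n (A.h k l) := rfl

theorem higherTerms_mem (A : AdmissibleForm) :
    A.higherTerms ∈ SuppIn fun k l _ => 2 ≤ k ∧ 2 ≤ l := by
  intro k l n hn
  by_contra h
  rw [coeff_higherTerms, A.h_eq_zero k l (by omega)] at hn
  simp at hn

theorem ε_ne_zero (A : AdmissibleForm) : (A.ε : ℂ) ≠ 0 := by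
  rcases A.ε_eq with h | h <;> simp [h]

theorem leading_mem (A : AdmissibleForm) (h : S 1 1 0) :
    C (A.ε : ℂ) * X 0 * X 1 ∈ SuppIn S := by
  rw [mul_assoc]
  refine C_mul_mem ?_ _
  simpa using X_pow_mem h

theorem reducedSeries_mem (A : AdmissibleForm) :
    reducedSeries A ∈ SuppIn fun k l n => 1 ≤ k ∧ 1 ≤ l ∧ 2 ≤ k + l + n := by
  refine add_mem (leading_mem A (by omega)) ?_
  exact suppIn_mono (higherTerms_mem A) fun k l n h => by omega

theorem coeff_reducedSeries_one_one (A : AdmissibleForm) :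
    coeff (e3 1 1 0) (reducedSeries A) = A.ε := by
  rw [reducedSeries, map_add, coeff_eq_zero_of_mem (higherTerms_mem A) (by omega), mul_assoc,
    coeff_C_mul]
  have := coeff_X_pow 1 1 0 1 1 0
  simp only [pow_one, pow_zero, mul_one, and_self, if_true] at this
  rw [this, mul_one, add_zero]

theorem definingSeries_eq (A : AdmissibleForm) :
    A.definingSeries = C (1 / 2 : ℂ) * X 2 ^ A.m * reducedSeries A := rfl

theorem wSeries_eq (A : AdmissibleForm) :
    A.wSeries = X 2 + C (Complex.I / 2) * (X 2 ^ A.m * reducedSeries A) := by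
  rw [AdmissibleForm.wSeries, definingSeries_eq, ← mul_assoc, ← mul_assoc, ← mul_assoc, ← map_mul]
  congr 4; ring

theorem wConjSeries_eq (A : AdmissibleForm) :
    A.wConjSeries = X 2 - C (Complex.I / 2) * (X 2 ^ A.m * reducedSeries A) := by
  rw [AdmissibleForm.wConjSeries, definingSeries_eq, ← mul_assoc, ← mul_assoc, ← mul_assoc,
    ← map_mul]
  congr 4; ring

theorem wSeries_sub_wConjSeries (A : AdmissibleForm) :
    A.wSeries - A.wConjSeries = C Complex.I * (X 2 ^ A.m * reducedSeries A) := by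
  have : (C Complex.I : MvPowerSeries (Fin 3) ℂ) = C (Complex.I / 2) + C (Complex.I / 2) := by
    rw [← map_add]; congr 1; ring
  rw [wSeries_eq, wConjSeries_eq, this]; ring

theorem u_pow_mul_reducedSeries_mem (A : AdmissibleForm) :
    X 2 ^ A.m * reducedSeries A ∈
      SuppIn fun k l n => 1 ≤ k ∧ 1 ≤ l ∧ A.m ≤ n ∧ A.m + 2 ≤ k + l + n := by
  refine mul_mem_suppIn (S := fun k l n => k = 0 ∧ l = 0 ∧ n = A.m) (X2_pow_mem (by omega))
    (reducedSeries_mem A) fun _ _ _ _ _ _ h h' => by omega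

/-- Fuchsian type as a condition on the support. -/
theorem isFuchsian_iff (A : AdmissibleForm) :
    A.IsFuchsian ↔ A.higherTerms ∈ SuppIn (Kset A.m (2 * A.m + 5) 0) := by
  have hm := A.one_le_m
  -- The definition of Fuchsian type bounds h_{2l} but not h_{k2}; reality of the equation transfers
  -- the bounds.
  have hsymm : ∀ k l n, PowerSeries.coeff n (A.h k l) ≠ 0 → PowerSeries.coeff n (A.h l k) ≠ 0 := by
    intro k l n h
    rw [← A.h_conj, PowerSeries.coeff_map]
    simpa using h
  constructor
  · rintro ⟨h22, h23, h33, h2l, hkl⟩ k l n hn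
    rw [coeff_higherTerms] at hn
    have key : ∀ k l b : ℕ, ((b : ℕ) : ℕ∞) ≤ (A.h k l).order →
        PowerSeries.coeff n (A.h k l) ≠ 0 → b ≤ n := by
      intro k l b hb hne
      exact_mod_cast hb.trans (PowerSeries.order_le n hne)
    have two : ∀ l, 2 ≤ l → PowerSeries.coeff n (A.h 2 l) ≠ 0 →
        (l = 2 → A.m - 1 ≤ n) ∧ (l = 3 → 2 * A.m - 2 ≤ n) ∧ (4 ≤ l → 2 * A.m + 2 ≤ n + l) := by
      intro l hl hne
      refine ⟨?_, ?_, fun h4 => ?_⟩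
      · rintro rfl; exact key 2 2 _ h22 hne
      · rintro rfl; exact key 2 3 _ h23 hne
      · by_cases hl' : l ≤ 2 * A.m + 1
        · have := key 2 l _ (h2l l h4 hl') hne; omega
        -- For l ≥ 2m + 2 the required inequality 2m + 2 ≤ n + l is automatic.
        · omega
    have hk : 2 ≤ k := (higherTerms_mem A k l n hn).1
    have hl : 2 ≤ l := (higherTerms_mem A k l n hn).2
    by_cases hk2 : k = 2
    · subst hk2
      have := two l hl hn
      unfold Kset Tset; omega
    by_cases hl2 : l = 2
    · subst hl2
      have := two k hk (hsymm _ _ _ hn)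
      unfold Kset Tset; omega
    by_cases h3 : k = 3 ∧ l = 3
    · obtain ⟨rfl, rfl⟩ := h3
      have := key 3 3 _ h33 hn
      unfold Kset Tset; omega
    · by_cases h7 : k + l ≤ 2 * A.m + 4
      · have := key k l _ (hkl k l (by omega) (by omega) (by omega) h7) hn
        unfold Kset Tset; omega
      · unfold Kset Tset; omega
  · intro h
    have key : ∀ k l b : ℕ, (∀ n, Kset A.m (2 * A.m + 5) 0 k l n → b ≤ n) →
        ((b : ℕ) : ℕ∞) ≤ (A.h k l).order := by
      intro k l b hb
      refine PowerSeries.nat_le_order _ _ fun i hi => ?_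
      by_contra hne
      have := hb i (h k l i hne)
      omega
    -- For k, l ≥ 2 the clauses of `Kset` give: degree at least m + 3 for (2,2); at least 2m + 3 for
    -- (2,3); at least 2m + 4 for (3,3) and for (2,l) with l ≥ 4; at least 2m + 5 otherwise.
    -- Subtracting k + l leaves the Fuchsian bounds on the order in u.
    refine ⟨key _ _ _ ?_, key _ _ _ ?_, key _ _ _ ?_, fun l h4 hl => key _ _ _ ?_,
      fun k l hk hl h7 hkl => key _ _ _ ?_⟩ <;> intro n hn <;> unfold Kset Tset at hn <;> omega

end FuchsianInvariance

end

/-! ### Restriction to the hypersurface and first consequences of the mapping identity. -/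

noncomputable section

namespace FuchsianInvariance

open MvPowerSeries

variable {S S' U : ℕ → ℕ → ℕ → Prop}

/-- Conjugation of the coefficients. -/
def conjSeries (P : MvPowerSeries (Fin 2) ℂ) : MvPowerSeries (Fin 2) ℂ :=
  MvPowerSeries.map (starRingEnd ℂ) P

theorem coeff_conjSeries (P : MvPowerSeries (Fin 2) ℂ) (d : Fin 2 →₀ ℕ) :
    coeff d (conjSeries P) = conj (coeff d P) := coeff_map _ _ _

theorem coeff_conjSeries_ne_zero {P : MvPowerSeries (Fin 2) ℂ} {d : Fin 2 →₀ ℕ}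
    (h : coeff d (conjSeries P) ≠ 0) : coeff d P ≠ 0 := by
  rw [coeff_conjSeries] at h
  simpa using h

theorem hasSubst2 {x t : MvPowerSeries (Fin 3) ℂ} (hx : x ∈ SuppIn (Dset 1))
    (ht : t ∈ SuppIn (Dset 1)) : HasSubst ![x, t] :=
  hasSubst_of_mem <| Fin.forall_fin_two.2 ⟨hx, ht⟩

theorem hasSubst3 {x y t : MvPowerSeries (Fin 3) ℂ} (hx : x ∈ SuppIn (Dset 1))
    (hy : y ∈ SuppIn (Dset 1)) (ht : t ∈ SuppIn (Dset 1)) : HasSubst ![x, y, t] := by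
  refine hasSubst_of_mem fun s => ?_
  fin_cases s
  exacts [hx, hy, ht]

theorem X0_mem_D : (X 0 : MvPowerSeries (Fin 3) ℂ) ∈ SuppIn (Dset 1) := X0_mem (by unfold Dset; omega)
theorem X1_mem_D : (X 1 : MvPowerSeries (Fin 3) ℂ) ∈ SuppIn (Dset 1) := X1_mem (by unfold Dset; omega)
theorem X2_mem_D : (X 2 : MvPowerSeries (Fin 3) ℂ) ∈ SuppIn (Dset 1) := X2_mem (by unfold Dset; omega)

/-- The exponents that occur in `w - u` on an admissible hypersurface. -/
def Wset (m k l n : ℕ) : Prop := 1 ≤ k ∧ 1 ≤ l ∧ m ≤ n ∧ m + 2 ≤ k + l + n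

theorem wSeries_sub_mem (A : AdmissibleForm) : A.wSeries - X 2 ∈ SuppIn (Wset A.m) := by
  rw [wSeries_eq, add_sub_cancel_left]
  exact C_mul_mem (u_pow_mul_reducedSeries_mem A) _

theorem wConjSeries_sub_mem (A : AdmissibleForm) : A.wConjSeries - X 2 ∈ SuppIn (Wset A.m) := by
  rw [wConjSeries_eq, sub_sub_cancel_left]
  exact neg_mem (C_mul_mem (u_pow_mul_reducedSeries_mem A) _)

theorem mem_of_sub_X2_mem {m : ℕ} {t : MvPowerSeries (Fin 3) ℂ}
    (ht : t - X 2 ∈ SuppIn (Wset m)) (h : S 0 0 1)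
    (h' : ∀ k l n, Wset m k l n → S k l n) : t ∈ SuppIn S := by
  rw [← sub_add_cancel t (X 2)]
  exact add_mem (suppIn_mono ht h') (X2_mem h)

theorem D_of_sub_X2_mem {m : ℕ} {t : MvPowerSeries (Fin 3) ℂ}
    (ht : t - X 2 ∈ SuppIn (Wset m)) : t ∈ SuppIn (Dset 1) :=
  mem_of_sub_X2_mem ht (by unfold Dset; omega) fun k l n h => by unfold Dset Wset at *; omega

theorem hasSubst_wSeries (A : AdmissibleForm) :
    HasSubst ![(X 0 : MvPowerSeries (Fin 3) ℂ), A.wSeries] :=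
  hasSubst2 X0_mem_D (D_of_sub_X2_mem (wSeries_sub_mem A))

theorem hasSubst_wConjSeries (A : AdmissibleForm) :
    HasSubst ![(X 1 : MvPowerSeries (Fin 3) ℂ), A.wConjSeries] :=
  hasSubst2 X1_mem_D (D_of_sub_X2_mem (wConjSeries_sub_mem A))

/-- By telescoping, every term contains one factor w - u, divisible by z \bar z u^m, and j - 1
further factors w or u, each divisible by u. -/
theorem pow_sub_X2_pow_mem {m : ℕ} {t : MvPowerSeries (Fin 3) ℂ}
    (ht : t - X 2 ∈ SuppIn (Wset m)) (hm : 1 ≤ m) (j : ℕ) :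
    t ^ j - X 2 ^ j ∈ SuppIn fun k l n => 1 ≤ k ∧ 1 ≤ l ∧ m + j ≤ n + 1 ∧ m + 1 + j ≤ k + l + n := by
  induction j with
  | zero => simp
  | succ j ih =>
    have : t ^ (j + 1) - X 2 ^ (j + 1) = (t ^ j - X 2 ^ j) * t + (t - X 2) * X 2 ^ j := by ring
    rw [this]
    have ht' : t ∈ SuppIn (fun k l n => 1 ≤ k + l + n ∧ 1 ≤ n) :=
      mem_of_sub_X2_mem ht (by omega) fun k l n h => by unfold Wset at *; omega
    refine add_mem (mul_mem_suppIn ih ht' fun _ _ _ _ _ _ h h' => by omega) ?_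
    refine mul_mem_suppIn (S' := fun k l n => k = 0 ∧ l = 0 ∧ n = j) ht (X2_pow_mem (by omega))
      fun _ _ _ _ _ _ h h' => by unfold Wset at *; omega

/-- Replacing w by u in P(z, w) costs only mixed monomials of high order. The target set `S` is left
free, so that each application reduces to linear arithmetic on exponents. -/
theorem pullback_sub_mem (A : AdmissibleForm) {P : MvPowerSeries (Fin 2) ℂ}
    (h : ∀ k j, coeff (e2 k j) P ≠ 0 → 1 ≤ j → ∀ k' l' n', k + 1 ≤ k' → 1 ≤ l' →
      A.m + j ≤ n' + 1 → A.m + 1 + k + j ≤ k' + l' + n' → S k' l' n') :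
    A.pullback P - subst ![(X 0 : MvPowerSeries (Fin 3) ℂ), X 2] P ∈ SuppIn S := by
  refine subst2_sub_mem (hasSubst_wSeries A) HasSubst.X_X fun k j hkj => ?_
  rw [← mul_sub]
  rcases Nat.eq_zero_or_pos j with rfl | hj
  · simp
  have hX : (X 0 ^ k : MvPowerSeries (Fin 3) ℂ) ∈ SuppIn fun k' l' n' => k' = k ∧ l' = 0 ∧ n' = 0 := by
    simpa using X_pow_mem (k := k) (l := 0) (n := 0)
      (S := fun k' l' n' => k' = k ∧ l' = 0 ∧ n' = 0) (by omega)
  refine mul_mem_suppIn hX (pow_sub_X2_pow_mem (wSeries_sub_mem A) A.one_le_m j)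
    fun _ _ _ _ _ _ h1 h2 => h k j hkj hj _ _ _ ?_ ?_ ?_ ?_ <;> omega

theorem pullbackConj_sub_mem (A : AdmissibleForm) {P : MvPowerSeries (Fin 2) ℂ}
    (h : ∀ k j, coeff (e2 k j) P ≠ 0 → 1 ≤ j → ∀ k' l' n', k + 1 ≤ l' → 1 ≤ k' →
      A.m + j ≤ n' + 1 → A.m + 1 + k + j ≤ k' + l' + n' → S k' l' n') :
    A.pullbackConj P - subst ![(X 1 : MvPowerSeries (Fin 3) ℂ), X 2] (conjSeries P) ∈ SuppIn S := by
  refine subst2_sub_mem (hasSubst_wConjSeries A) HasSubst.X_X fun k j hkj => ?_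
  replace hkj := coeff_conjSeries_ne_zero hkj
  rw [← mul_sub]
  rcases Nat.eq_zero_or_pos j with rfl | hj
  · simp
  have hX : (X 1 ^ k : MvPowerSeries (Fin 3) ℂ) ∈ SuppIn fun k' l' n' => l' = k ∧ k' = 0 ∧ n' = 0 := by
    simpa using X_pow_mem (k := 0) (l := k) (n := 0)
      (S := fun k' l' n' => l' = k ∧ k' = 0 ∧ n' = 0) (by omega)
  refine mul_mem_suppIn hX (pow_sub_X2_pow_mem (wConjSeries_sub_mem A) A.one_le_m j)
    fun _ _ _ _ _ _ h1 h2 => h k j hkj hj _ _ _ ?_ ?_ ?_ ?_ <;> omega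

/-- If `f - g` has no coefficient at an exponent, then `f` and `g` agree there. -/
theorem coeff_eq_of_sub_mem {f g : MvPowerSeries (Fin 3) ℂ} (h : f - g ∈ SuppIn S) {k l n : ℕ}
    (hS : ¬ S k l n) : coeff (e3 k l n) f = coeff (e3 k l n) g := by
  rw [← sub_eq_zero, ← map_sub]
  exact coeff_eq_zero_of_mem h hS

/-- The error of replacing w by u is divisible by z \bar z, hence invisible on monomials that lack z
or \bar z. -/
theorem coeff_pullback_of_eq_zero (A : AdmissibleForm) (P : MvPowerSeries (Fin 2) ℂ) {k l n : ℕ}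
    (h : k = 0 ∨ l = 0) :
    coeff (e3 k l n) (A.pullback P) = if l = 0 then coeff (e2 k n) P else 0 := by
  rw [← coeff_subst2_X0_X2]
  refine coeff_eq_of_sub_mem (S := fun k l _ => 1 ≤ k ∧ 1 ≤ l)
    (pullback_sub_mem A fun _ _ _ _ _ _ _ _ _ _ _ => by omega) (by omega)

theorem coeff_pullbackConj_of_eq_zero (A : AdmissibleForm) (P : MvPowerSeries (Fin 2) ℂ)
    {k l n : ℕ} (h : k = 0 ∨ l = 0) :
    coeff (e3 k l n) (A.pullbackConj P) = if k = 0 then conj (coeff (e2 l n) P) else 0 := by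
  rw [← coeff_conjSeries, ← coeff_subst2_X1_X2]
  refine coeff_eq_of_sub_mem (S := fun k l _ => 1 ≤ k ∧ 1 ≤ l)
    (pullbackConj_sub_mem A fun _ _ _ _ _ _ _ _ _ _ _ => by omega) (by omega)

/-- The linear part of a pullback. -/
theorem pullback_sub_linear_mem (A : AdmissibleForm) {P : MvPowerSeries (Fin 2) ℂ}
    (h0 : coeff (e2 0 0) P = 0) :
    A.pullback P - (C (coeff (e2 1 0) P) * X 0 + C (coeff (e2 0 1) P) * X 2) ∈
      SuppIn (Dset 2) := by
  intro k l n hn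
  by_contra hlt
  unfold Dset at hlt
  apply hn
  have h1 := coeff_X_pow 1 0 0 k l n
  have h2 := coeff_X_pow 0 0 1 k l n
  simp only [pow_zero, pow_one, mul_one, one_mul] at h1 h2
  rw [map_sub, map_add, coeff_C_mul, coeff_C_mul, h1, h2,
    coeff_pullback_of_eq_zero A P (by omega)]
  have : (k = 0 ∧ l = 0 ∧ n = 0) ∨ (k = 1 ∧ l = 0 ∧ n = 0) ∨ (k = 0 ∧ l = 1 ∧ n = 0) ∨
    (k = 0 ∧ l = 0 ∧ n = 1) := by omega
  rcases this with ⟨rfl, rfl, rfl⟩ | ⟨rfl, rfl, rfl⟩ | ⟨rfl, rfl, rfl⟩ | ⟨rfl, rfl, rfl⟩ <;> simp [h0]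

theorem pullbackConj_sub_linear_mem (A : AdmissibleForm) {P : MvPowerSeries (Fin 2) ℂ}
    (h0 : coeff (e2 0 0) P = 0) :
    A.pullbackConj P - (C (conj (coeff (e2 1 0) P)) * X 1 + C (conj (coeff (e2 0 1) P)) * X 2) ∈
      SuppIn (Dset 2) := by
  intro k l n hn
  by_contra hlt
  unfold Dset at hlt
  apply hn
  have h1 := coeff_X_pow 0 1 0 k l n
  have h2 := coeff_X_pow 0 0 1 k l n
  simp only [pow_zero, pow_one, mul_one, one_mul] at h1 h2
  rw [map_sub, map_add, coeff_C_mul, coeff_C_mul, h1, h2,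
    coeff_pullbackConj_of_eq_zero A P (by omega)]
  have : (k = 0 ∧ l = 0 ∧ n = 0) ∨ (k = 1 ∧ l = 0 ∧ n = 0) ∨ (k = 0 ∧ l = 1 ∧ n = 0) ∨
    (k = 0 ∧ l = 0 ∧ n = 1) := by omega
  rcases this with ⟨rfl, rfl, rfl⟩ | ⟨rfl, rfl, rfl⟩ | ⟨rfl, rfl, rfl⟩ | ⟨rfl, rfl, rfl⟩ <;> simp [h0]

theorem linear_mem_D (a b : ℂ) (i j : Fin 3) :
    C a * X i + C b * X j ∈ SuppIn (Dset 1) := by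
  have hX : ∀ i : Fin 3, (X i : MvPowerSeries (Fin 3) ℂ) ∈ SuppIn (Dset 1) := by
    intro i
    fin_cases i
    exacts [X0_mem_D, X1_mem_D, X2_mem_D]
  exact add_mem (C_mul_mem (hX i) a) (C_mul_mem (hX j) b)

theorem mem_D_of_sub {f g : MvPowerSeries (Fin 3) ℂ} (h : f - g ∈ SuppIn (Dset 2))
    (hg : g ∈ SuppIn (Dset 1)) : f ∈ SuppIn (Dset 1) := by
  rw [← sub_add_cancel f g]
  exact add_mem (mem_D_mono h (by omega)) hg

theorem pullback_mem_D (A : AdmissibleForm) {P : MvPowerSeries (Fin 2) ℂ}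
    (h0 : coeff (e2 0 0) P = 0) : A.pullback P ∈ SuppIn (Dset 1) :=
  mem_D_of_sub (pullback_sub_linear_mem A h0) (linear_mem_D _ _ _ _)

theorem pullbackConj_mem_D (A : AdmissibleForm) {P : MvPowerSeries (Fin 2) ℂ}
    (h0 : coeff (e2 0 0) P = 0) : A.pullbackConj P ∈ SuppIn (Dset 1) :=
  mem_D_of_sub (pullbackConj_sub_linear_mem A h0) (linear_mem_D _ _ _ _)

/-- The restriction of `Re G` to the hypersurface. -/
def rePullback (A : AdmissibleForm) (P : MvPowerSeries (Fin 2) ℂ) : MvPowerSeries (Fin 3) ℂ :=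
  C (1 / 2 : ℂ) * (A.pullback P + A.pullbackConj P)

theorem rePullback_mem_D (A : AdmissibleForm) {P : MvPowerSeries (Fin 2) ℂ}
    (h0 : coeff (e2 0 0) P = 0) : rePullback A P ∈ SuppIn (Dset 1) :=
  C_mul_mem (add_mem (pullback_mem_D A h0) (pullbackConj_mem_D A h0)) _

/-- A formal map between admissible hypersurfaces: the coefficients of `F` and `G` at the origin
vanish and the mapping identity holds. -/
structure FormalMap (A A' : AdmissibleForm) (F G : MvPowerSeries (Fin 2) ℂ) : Prop where
  F_zero : coeff (e2 0 0) F = 0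
  G_zero : coeff (e2 0 0) G = 0
  det_ne : coeff (e2 1 0) F * coeff (e2 0 1) G - coeff (e2 0 1) F * coeff (e2 1 0) G ≠ 0
  eqn : A.pullback G - A.pullbackConj G =
    C Complex.I * (rePullback A G ^ A'.m *
      subst ![A.pullback F, A.pullbackConj F, rePullback A G] (reducedSeries A'))

variable {A A' : AdmissibleForm} {F G : MvPowerSeries (Fin 2) ℂ}

theorem e2_zero_zero : e2 0 0 = 0 := by ext i; fin_cases i <;> rfl

theorem e2_one_zero : e2 1 0 = Finsupp.single 0 1 := by
  ext i; fin_cases i <;> simp [e2]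

theorem e2_zero_one : e2 0 1 = Finsupp.single 1 1 := by
  ext i; fin_cases i <;> simp [e2]

theorem FormalMap.of_mapsFormally (h : IsFormalCoordinateChange F G) (h' : MapsFormally F G A A') :
    FormalMap A A' F G := by
  obtain ⟨hF, hG, hdet⟩ := h
  have hF' : coeff (e2 0 0) F = 0 := by rwa [e2_zero_zero, coeff_zero_eq_constantCoeff_apply]
  have hG' : coeff (e2 0 0) G = 0 := by rwa [e2_zero_zero, coeff_zero_eq_constantCoeff_apply]
  refine ⟨hF', hG', by rwa [e2_one_zero, e2_zero_one], ?_⟩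
  have hs : HasSubst ![A.pullback F, A.pullbackConj F, rePullback A G] :=
    hasSubst3 (pullback_mem_D A hF') (pullbackConj_mem_D A hF') (rePullback_mem_D A hG')
  have e : C (1 / (2 * Complex.I)) * (A.pullback G - A.pullbackConj G) =
      subst ![A.pullback F, A.pullbackConj F, rePullback A G] A'.definingSeries := h'
  rw [definingSeries_eq, mul_assoc, ← smul_eq_C_mul (_ * _) (1 / 2 : ℂ), subst_smul hs,
    subst_mul hs, subst_pow hs, subst_X hs] at e
  simp only [Matrix.cons_val] at e
  have e' := congrArg (fun f => C (2 * Complex.I) * f) e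
  simp only [← mul_assoc, ← map_mul, smul_eq_C_mul] at e'
  have h2 : (2 * Complex.I) * (1 / (2 * Complex.I)) = 1 := by
    field_simp [Complex.I_ne_zero]
  have h3 : 2 * Complex.I * (1 / 2) = Complex.I := by ring
  rw [h2, h3, map_one, one_mul] at e'
  rw [e', mul_assoc]

namespace FormalMap

variable (h : FormalMap A A' F G)
include h

theorem x_mem_D : A.pullback F ∈ SuppIn (Dset 1) := pullback_mem_D A h.F_zero
theorem y_mem_D : A.pullbackConj F ∈ SuppIn (Dset 1) := pullbackConj_mem_D A h.F_zero
theorem t_mem_D : rePullback A G ∈ SuppIn (Dset 1) := rePullback_mem_D A h.G_zero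

theorem hasSubst : HasSubst ![A.pullback F, A.pullbackConj F, rePullback A G] :=
  hasSubst3 h.x_mem_D h.y_mem_D h.t_mem_D

theorem subst_reducedSeries :
    subst ![A.pullback F, A.pullbackConj F, rePullback A G] (reducedSeries A') =
      C (A'.ε : ℂ) * (A.pullback F * A.pullbackConj F) +
        subst ![A.pullback F, A.pullbackConj F, rePullback A G] A'.higherTerms := by
  rw [reducedSeries, subst_add h.hasSubst, mul_assoc, ← smul_eq_C_mul, subst_smul h.hasSubst,
    subst_mul h.hasSubst, subst_X h.hasSubst, subst_X h.hasSubst, smul_eq_C_mul]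
  rfl

/-- The image of the locus `u = 0` lies in the locus `u = 0`. -/
theorem coeff_G_zero (k : ℕ) : coeff (e2 k 0) G = 0 := by
  -- Work modulo the ideal generated by \bar z and u. There \bar F vanishes, and every monomial of
  -- H' contains \bar z, so the right-hand side of the mapping identity vanishes too; what is left
  -- is G(z, 0) = \bar G(0, 0) = 0.
  have hy : A.pullbackConj F ∈ SuppIn fun _ l n => 1 ≤ l ∨ 1 ≤ n := by
    intro k l n hn
    by_contra hln
    obtain ⟨rfl, rfl⟩ : l = 0 ∧ n = 0 := by omega
    rw [coeff_pullbackConj_of_eq_zero A F (by omega)] at hn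
    split_ifs at hn with hk
    · simp [h.F_zero] at hn
    · exact hn rfl
  have hideal : ∀ f g : MvPowerSeries (Fin 3) ℂ, (g ∈ SuppIn fun _ l n => 1 ≤ l ∨ 1 ≤ n) →
      f * g ∈ SuppIn fun _ l n => 1 ≤ l ∨ 1 ≤ n := fun f g hg =>
    mul_mem_suppIn (mem_D_zero f) hg fun _ _ _ _ _ _ _ h' => by omega
  have hs : subst ![A.pullback F, A.pullbackConj F, rePullback A G] (reducedSeries A') ∈
      SuppIn fun _ l n => 1 ≤ l ∨ 1 ≤ n := by
    refine subst3_mem h.hasSubst fun k l n hn => ?_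
    obtain ⟨l, rfl⟩ : ∃ l', l = l' + 1 := ⟨l - 1, by have := reducedSeries_mem A' k l n hn; omega⟩
    have : A.pullback F ^ k * A.pullbackConj F ^ (l + 1) * rePullback A G ^ n =
      (A.pullback F ^ k * A.pullbackConj F ^ l * rePullback A G ^ n) * A.pullbackConj F := by ring
    rw [this]
    exact hideal _ _ hy
  have hR := C_mul_mem (hideal (rePullback A G ^ A'.m) _ hs) Complex.I
  rw [← h.eqn] at hR
  have := coeff_eq_of_sub_mem hR (k := k) (l := 0) (n := 0) (by omega)
  rw [coeff_pullback_of_eq_zero A G (by omega), coeff_pullbackConj_of_eq_zero A G (by omega)] at this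
  rcases Nat.eq_zero_or_pos k with rfl | hk
  · exact h.G_zero
  · rwa [if_pos rfl, if_neg (by omega)] at this

theorem coeff_F_ne_zero : coeff (e2 1 0) F ≠ 0 := by
  intro h0
  apply h.det_ne
  rw [h0, h.coeff_G_zero 1]; ring

theorem coeff_G_ne_zero : coeff (e2 0 1) G ≠ 0 := by
  intro h0
  apply h.det_ne
  rw [h0, h.coeff_G_zero 1]; ring

theorem rhs_mem_D :
    subst ![A.pullback F, A.pullbackConj F, rePullback A G] (reducedSeries A') ∈
      SuppIn (Dset 2) := by
  refine subst3_mem h.hasSubst fun k l n hn => ?_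
  have := reducedSeries_mem A' k l n hn
  exact mem_D_mono (mul_mem_D (mul_mem_D (pow_mem_D h.x_mem_D k) (pow_mem_D h.y_mem_D l))
    (pow_mem_D h.t_mem_D n)) (by omega)

/-- The right-hand side of the mapping identity has order at least m' + 2, so the coefficient of u
in G - \bar G vanishes. -/
theorem conj_coeff_G : conj (coeff (e2 0 1) G) = coeff (e2 0 1) G := by
  have hm := A'.one_le_m
  have hR := C_mul_mem (mul_mem_D (pow_mem_D h.t_mem_D A'.m) h.rhs_mem_D) Complex.I
  rw [← h.eqn] at hR
  have := coeff_eq_of_sub_mem hR (k := 0) (l := 0) (n := 1) (by unfold Dset; omega)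
  rw [coeff_pullback_of_eq_zero A G (by omega),
    coeff_pullbackConj_of_eq_zero A G (by omega)] at this
  simpa using this.symm

theorem t_sub_mem_D : rePullback A G - C (coeff (e2 0 1) G) * X 2 ∈ SuppIn (Dset 2) := by
  have h1 := pullback_sub_linear_mem A h.G_zero
  have h2 := pullbackConj_sub_linear_mem A h.G_zero
  rw [h.coeff_G_zero 1, map_zero, zero_mul, zero_add] at h1
  rw [h.coeff_G_zero 1, h.conj_coeff_G, map_zero, map_zero, zero_mul, zero_add] at h2
  have h3 := C_mul_mem (add_mem h1 h2) (1 / 2)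
  convert h3 using 1
  have : (C (1 / 2 : ℂ) + C (1 / 2 : ℂ) : MvPowerSeries (Fin 3) ℂ) = 1 := by
    rw [← map_add, ← map_one (C (σ := Fin 3) (R := ℂ))]; norm_num
  rw [rePullback]
  linear_combination (C (coeff (e2 0 1) G) * X 2) * this

/-- G is divisible by w because G(z, 0) = 0, and both w and \bar w are divisible by u on the
hypersurface because m ≥ 1. -/
theorem t_mem_U : rePullback A G ∈ SuppIn (Uset 1) := by
  have hG : ∀ k j, coeff (e2 k j) G ≠ 0 → 1 ≤ j := by
    intro k j hkj
    by_contra hj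
    obtain rfl : j = 0 := by omega
    exact hkj (h.coeff_G_zero k)
  have hw : ∀ t : MvPowerSeries (Fin 3) ℂ, t - X 2 ∈ SuppIn (Wset A.m) → t ∈ SuppIn (Uset 1) :=
    fun t ht => mem_of_sub_X2_mem ht (by unfold Uset; omega) fun k l n h => by
      have := A.one_le_m
      unfold Uset Wset at *; omega
  refine C_mul_mem (add_mem ?_ ?_) _
  · refine subst2_mem (hasSubst_wSeries A) fun k j hkj => ?_
    have := hG k j hkj
    exact mem_U_mono (mul_mem_U (mem_U_zero _) (pow_mem_U (hw _ (wSeries_sub_mem A)) j)) (by omega)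
  · refine subst2_mem (hasSubst_wConjSeries A) fun k j hkj => ?_
    have := hG k j (coeff_conjSeries_ne_zero hkj)
    exact mem_U_mono (mul_mem_U (mem_U_zero _) (pow_mem_U (hw _ (wConjSeries_sub_mem A)) j))
      (by omega)

end FormalMap

end FuchsianInvariance

end

/-! ### Invariance of the exponent m. -/

noncomputable section

namespace FuchsianInvariance

open MvPowerSeries

variable {S S' U : ℕ → ℕ → ℕ → Prop} {A A' : AdmissibleForm} {F G : MvPowerSeries (Fin 2) ℂ}

theorem pullback_sub (A : AdmissibleForm) (P Q : MvPowerSeries (Fin 2) ℂ) :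
    A.pullback (P - Q) = A.pullback P - A.pullback Q := subst_sub (hasSubst_wSeries A) P Q

theorem pullbackConj_sub (A : AdmissibleForm) (P Q : MvPowerSeries (Fin 2) ℂ) :
    A.pullbackConj (P - Q) = A.pullbackConj P - A.pullbackConj Q := by
  rw [AdmissibleForm.pullbackConj, map_sub]
  exact subst_sub (hasSubst_wConjSeries A) _ _

theorem pullback_C_mul_X (A : AdmissibleForm) (c : ℂ) :
    A.pullback (C c * X 1) = C c * A.wSeries := by
  rw [AdmissibleForm.pullback, ← smul_eq_C_mul, subst_smul (hasSubst_wSeries A),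
    subst_X (hasSubst_wSeries A), smul_eq_C_mul]
  rfl

theorem pullbackConj_C_mul_X (A : AdmissibleForm) (c : ℂ) :
    A.pullbackConj (C c * X 1) = C (conj c) * A.wConjSeries := by
  rw [AdmissibleForm.pullbackConj, map_mul, map_C, map_X, ← smul_eq_C_mul,
    subst_smul (hasSubst_wConjSeries A), subst_X (hasSubst_wConjSeries A), smul_eq_C_mul]
  rfl

theorem coeff_sub_C_mul_X (P : MvPowerSeries (Fin 2) ℂ) (k j : ℕ) :
    coeff (e2 k j) (P - C (coeff (e2 0 1) P) * X 1) =
      if k = 0 ∧ j = 1 then 0 else coeff (e2 k j) P := by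
  classical
  rw [map_sub, coeff_C_mul, coeff_X, ← e2_zero_one]
  simp only [e2_inj]
  split_ifs with h
  · rw [h.1, h.2]; ring
  · ring

namespace FormalMap

variable (h : FormalMap A A' F G)
include h

/-- The mixed leading coefficient of `G - \bar G` on the hypersurface. -/
theorem coeff_lhs {n : ℕ} (hn : n ≤ A.m) :
    coeff (e3 1 1 n) (A.pullback G - A.pullbackConj G) =
      if n = A.m then coeff (e2 0 1) G * Complex.I * A.ε else 0 := by
  set c := coeff (e2 0 1) G with hc
  have hm := A.one_le_m
  -- After cw is split off, a remaining monomial z^k w^j produces on the hypersurface mixed terms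
  -- with z-exponent at least k + 1 and u-exponent at least m + j - 1. Since (k, j) ≠ (0, 1), none
  -- of them is z \bar z u^n with n ≤ m.
  have hG : ∀ k j, coeff (e2 k j) (G - C c * X 1) ≠ 0 → 1 ≤ k + j ∧ (k = 0 → j ≠ 1) := by
    intro k j hkj
    rw [hc, coeff_sub_C_mul_X] at hkj
    split_ifs at hkj with h'
    · exact absurd rfl hkj
    · refine ⟨?_, by omega⟩
      by_contra h0
      obtain ⟨rfl, rfl⟩ : k = 0 ∧ j = 0 := by omega
      exact hkj h.G_zero
  have h1 := coeff_eq_of_sub_mem (S := fun k l n => ¬ (k = 1 ∧ l = 1 ∧ n ≤ A.m))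
    (pullback_sub_mem A (P := G - C c * X 1) fun k j hkj _ k' l' n' _ _ _ _ => by
      have := hG k j hkj; omega) (k := 1) (l := 1) (n := n) (by omega)
  have h2 := coeff_eq_of_sub_mem (S := fun k l n => ¬ (k = 1 ∧ l = 1 ∧ n ≤ A.m))
    (pullbackConj_sub_mem A (P := G - C c * X 1) fun k j hkj _ k' l' n' _ _ _ _ => by
      have := hG k j hkj; omega) (k := 1) (l := 1) (n := n) (by omega)
  rw [pullback_sub, pullback_C_mul_X, coeff_subst2_X0_X2, if_neg one_ne_zero, map_sub,
    sub_eq_zero] at h1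
  rw [pullbackConj_sub, pullbackConj_C_mul_X, coeff_subst2_X1_X2, if_neg one_ne_zero, map_sub,
    sub_eq_zero, hc, h.conj_coeff_G] at h2
  rw [map_sub, h1, h2, ← map_sub, ← mul_sub, coeff_C_mul, wSeries_sub_wConjSeries, coeff_C_mul]
  split_ifs with hnm
  · subst hnm
    have := coeff_X2_pow_mul (reducedSeries A) 1 1 0 A.m
    rw [zero_add] at this
    rw [this, coeff_reducedSeries_one_one]; ring
  · rw [coeff_eq_zero_of_mem (u_pow_mul_reducedSeries_mem A) (by omega)]; simp

/-- The mixed leading coefficient of the right-hand side. -/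
theorem coeff_rhs :
    coeff (e3 1 1 A'.m) (rePullback A G ^ A'.m *
      subst ![A.pullback F, A.pullbackConj F, rePullback A G] (reducedSeries A')) =
      coeff (e2 0 1) G ^ A'.m * (A'.ε * (coeff (e2 1 0) F * conj (coeff (e2 1 0) F))) := by
  set a := coeff (e2 1 0) F with ha
  set c := coeff (e2 0 1) G with hc
  set x := A.pullback F
  set y := A.pullbackConj F
  set t := rePullback A G with ht
  -- The factor (Re G)^{m'} already carries u^{m'}, so terms of H'(F, \bar F, Re G) that contain u
  -- or have degree at least 3 cannot contribute to z \bar z u^{m'}.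
  let S0 : ℕ → ℕ → ℕ → Prop := fun k l n => 3 ≤ k + l + n ∨ 1 ≤ n
  have hx : x - C a * X 0 ∈ SuppIn fun k l n => 2 ≤ k + l + n ∨ 1 ≤ n := by
    have := suppIn_mono (S' := fun k l n => 2 ≤ k + l + n ∨ 1 ≤ n)
      (pullback_sub_linear_mem A h.F_zero) fun k l n h => Or.inl h
    have h2 := add_mem this (C_mul_mem (X2_mem (S := fun k l n => 2 ≤ k + l + n ∨ 1 ≤ n)
      (by omega)) (coeff (e2 0 1) F))
    convert h2 using 1
    ring
  have hy : y - C (conj a) * X 1 ∈ SuppIn fun k l n => 2 ≤ k + l + n ∨ 1 ≤ n := by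
    have := suppIn_mono (S' := fun k l n => 2 ≤ k + l + n ∨ 1 ≤ n)
      (pullbackConj_sub_linear_mem A h.F_zero) fun k l n h => Or.inl h
    have h2 := add_mem this (C_mul_mem (X2_mem (S := fun k l n => 2 ≤ k + l + n ∨ 1 ≤ n)
      (by omega)) (conj (coeff (e2 0 1) F)))
    convert h2 using 1
    ring
  have hxy : x * y - C (a * conj a) * (X 0 * X 1) ∈ SuppIn S0 := by
    have e : x * y - C (a * conj a) * (X 0 * X 1) =
      (x - C a * X 0) * y + (y - C (conj a) * X 1) * (C a * X 0) := by rw [map_mul]; ring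
    rw [e]
    refine add_mem (mul_mem_suppIn hx h.y_mem_D ?_)
      (mul_mem_suppIn hy (C_mul_mem X0_mem_D a) ?_) <;>
    · intro k l n k' l' n' h1 h2; simp only [Dset, S0] at *; omega
  have hhi : subst ![x, y, t] A'.higherTerms ∈ SuppIn S0 := by
    refine subst3_mem h.hasSubst fun k l n hn => ?_
    have hkl := higherTerms_mem A' k l n hn
    refine suppIn_mono (mul_mem_D (mul_mem_D (pow_mem_D h.x_mem_D k) (pow_mem_D h.y_mem_D l))
      (pow_mem_D h.t_mem_D n)) fun _ _ _ h' => Or.inl ?_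
    unfold Dset at h'; omega
  have hH : subst ![x, y, t] (reducedSeries A') -
      C (A'.ε * (a * conj a)) * (X 0 * X 1) ∈ SuppIn S0 := by
    rw [h.subst_reducedSeries]
    have := add_mem (C_mul_mem hxy (A'.ε : ℂ)) hhi
    convert this using 1
    rw [map_mul]; ring
  have hpow : t ^ A'.m - (C c * X 2) ^ A'.m ∈ SuppIn fun k l n => A'.m ≤ n ∧ A'.m + 1 ≤ k + l + n := by
    intro k l n hn
    have hcX : C c * X 2 ∈ SuppIn (Uset 1) := C_mul_mem (X2_mem (by unfold Uset; omega)) c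
    have h1 := pow_sub_pow_mem_D (e := 1) h.t_mem_D (C_mul_mem X2_mem_D c) h.t_sub_mem_D A'.m
    have h2 := sub_mem (pow_mem_U h.t_mem_U A'.m) (pow_mem_U hcX A'.m)
    have h3 := h1 k l n hn
    have h4 := h2 k l n hn
    unfold Dset Uset at *; omega
  have hmain : t ^ A'.m * subst ![x, y, t] (reducedSeries A') -
      C (c ^ A'.m * (A'.ε * (a * conj a))) * (X 0 * X 1 * X 2 ^ A'.m) ∈
      SuppIn fun k l n => ¬ (k = 1 ∧ l = 1 ∧ n = A'.m) := by
    have e : t ^ A'.m * subst ![x, y, t] (reducedSeries A') -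
        C (c ^ A'.m * (A'.ε * (a * conj a))) * (X 0 * X 1 * X 2 ^ A'.m) =
        (t ^ A'.m - (C c * X 2) ^ A'.m) * subst ![x, y, t] (reducedSeries A') +
        X 2 ^ A'.m * (C (c ^ A'.m) * (subst ![x, y, t] (reducedSeries A') -
      C (A'.ε * (a * conj a)) * (X 0 * X 1))) := by
      simp only [map_mul, map_pow]; ring
    rw [e]
    refine add_mem (mul_mem_suppIn hpow h.rhs_mem_D fun _ _ _ _ _ _ h1 h2 => by
      unfold Dset at h2; omega) ?_
    refine mul_mem_suppIn (S := fun k l n => k = 0 ∧ l = 0 ∧ n = A'.m) (X2_pow_mem (by omega))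
      (C_mul_mem hH _) fun _ _ _ _ _ _ h1 h2 => by simp only [S0] at h2; omega
  rw [coeff_eq_of_sub_mem hmain (by omega), coeff_C_mul]
  have := coeff_X_pow 1 1 A'.m 1 1 A'.m
  simp only [pow_one, and_self, if_true] at this
  rw [this, mul_one]

/-- Compare the coefficients of z \bar z u^n. On the left the first nonzero one is c i ε at n = m;
on the right everything is divisible by u^{m'}, and at n = m' the coefficient is i c^{m'} ε' |a|^2 ≠
0. If m ≠ m', the smaller of the two exponents gives a contradiction. -/
theorem m_eq : A.m = A'.m := by
  rcases lt_trichotomy A.m A'.m with hlt | heq | hgt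
  · exfalso
    have h1 := h.coeff_lhs le_rfl
    rw [if_pos rfl, h.eqn, coeff_C_mul, coeff_eq_zero_of_mem
      (mul_mem_U (pow_mem_U h.t_mem_U A'.m) (mem_U_zero _)) (by unfold Uset; omega),
      mul_zero] at h1
    exact mul_ne_zero (mul_ne_zero h.coeff_G_ne_zero Complex.I_ne_zero) (ε_ne_zero A) h1.symm
  · exact heq
  · exfalso
    have h1 := h.coeff_lhs hgt.le
    rw [if_neg hgt.ne, h.eqn, coeff_C_mul, h.coeff_rhs] at h1
    have h2 : conj (coeff (e2 1 0) F) ≠ 0 := by simpa using h.coeff_F_ne_zero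
    exact mul_ne_zero Complex.I_ne_zero (mul_ne_zero (pow_ne_zero _ h.coeff_G_ne_zero)
      (mul_ne_zero (ε_ne_zero A') (mul_ne_zero h.coeff_F_ne_zero h2))) h1

end FormalMap

end FuchsianInvariance

end

/-! ### Splitting of series into parts, and linear substitutions. -/

noncomputable section

namespace FuchsianInvariance

open MvPowerSeries

variable {S S' U : ℕ → ℕ → ℕ → Prop} {A A' : AdmissibleForm} {F G : MvPowerSeries (Fin 2) ℂ}

theorem Tset.swap {m N p q e k l n : ℕ} (h : Tset m N p q e k l n) : Tset m N q p e l k n := by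
  unfold Tset at *; omega

/-! ### Parts of series -/

open Classical in
/-- The part of a series in `z`, `w` with exponents in `p`. -/
def part2 (p : ℕ → ℕ → Prop) (P : MvPowerSeries (Fin 2) ℂ) : MvPowerSeries (Fin 2) ℂ :=
  fun d => if p (d 0) (d 1) then coeff d P else 0

open Classical in
/-- The part of a series in `z`, `\bar z`, `u` with exponents in `p`. -/
def part3 (p : ℕ → ℕ → ℕ → Prop) (P : MvPowerSeries (Fin 3) ℂ) : MvPowerSeries (Fin 3) ℂ :=
  fun d => if p (d 0) (d 1) (d 2) then coeff d P else 0

open Classical in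
theorem coeff_part2 (p : ℕ → ℕ → Prop) (P : MvPowerSeries (Fin 2) ℂ) (k j : ℕ) :
    coeff (e2 k j) (part2 p P) = if p k j then coeff (e2 k j) P else 0 := rfl

open Classical in
theorem coeff_part3 (p : ℕ → ℕ → ℕ → Prop) (P : MvPowerSeries (Fin 3) ℂ) (k l n : ℕ) :
    coeff (e3 k l n) (part3 p P) = if p k l n then coeff (e3 k l n) P else 0 := rfl

theorem of_coeff_part2_ne_zero {p : ℕ → ℕ → Prop} {P : MvPowerSeries (Fin 2) ℂ} {k j : ℕ}
    (h : coeff (e2 k j) (part2 p P) ≠ 0) : p k j ∧ coeff (e2 k j) P ≠ 0 := by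
  rw [coeff_part2] at h
  split_ifs at h with hp
  · exact ⟨hp, h⟩
  · exact absurd rfl h

theorem of_coeff_sub_part2_ne_zero {p : ℕ → ℕ → Prop} {P : MvPowerSeries (Fin 2) ℂ} {k j : ℕ}
    (h : coeff (e2 k j) (P - part2 p P) ≠ 0) : ¬ p k j ∧ coeff (e2 k j) P ≠ 0 := by
  rw [map_sub, coeff_part2] at h
  split_ifs at h with hp
  · exact absurd (sub_self _) h
  · exact ⟨hp, by rwa [sub_zero] at h⟩

theorem of_coeff_part3_ne_zero {p : ℕ → ℕ → ℕ → Prop} {P : MvPowerSeries (Fin 3) ℂ} {k l n : ℕ}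
    (h : coeff (e3 k l n) (part3 p P) ≠ 0) : p k l n ∧ coeff (e3 k l n) P ≠ 0 := by
  rw [coeff_part3] at h
  split_ifs at h with hp
  · exact ⟨hp, h⟩
  · exact absurd rfl h

theorem of_coeff_sub_part3_ne_zero {p : ℕ → ℕ → ℕ → Prop} {P : MvPowerSeries (Fin 3) ℂ}
    {k l n : ℕ} (h : coeff (e3 k l n) (P - part3 p P) ≠ 0) :
    ¬ p k l n ∧ coeff (e3 k l n) P ≠ 0 := by
  rw [map_sub, coeff_part3] at h
  split_ifs at h with hp
  · exact absurd (sub_self _) h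
  · exact ⟨hp, by rwa [sub_zero] at h⟩

/-- The series `P(z, u)`. -/
def lift (P : MvPowerSeries (Fin 2) ℂ) : MvPowerSeries (Fin 3) ℂ :=
  subst ![(X 0 : MvPowerSeries (Fin 3) ℂ), X 2] P

/-- The series `\bar P(\bar z, u)`. -/
def liftConj (P : MvPowerSeries (Fin 2) ℂ) : MvPowerSeries (Fin 3) ℂ :=
  subst ![(X 1 : MvPowerSeries (Fin 3) ℂ), X 2] (conjSeries P)

theorem coeff_lift (P : MvPowerSeries (Fin 2) ℂ) (k l n : ℕ) :
    coeff (e3 k l n) (lift P) = if l = 0 then coeff (e2 k n) P else 0 :=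
  coeff_subst2_X0_X2 P k l n

theorem coeff_liftConj (P : MvPowerSeries (Fin 2) ℂ) (k l n : ℕ) :
    coeff (e3 k l n) (liftConj P) = if k = 0 then conj (coeff (e2 l n) P) else 0 := by
  rw [liftConj, coeff_subst2_X1_X2, coeff_conjSeries]

theorem lift_mem {P : MvPowerSeries (Fin 2) ℂ} (h : ∀ k j, coeff (e2 k j) P ≠ 0 → S k 0 j) :
    lift P ∈ SuppIn S := by
  intro k l n hn
  rw [coeff_lift] at hn
  split_ifs at hn with hl
  · subst hl; exact h k n hn
  · exact absurd rfl hn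

theorem liftConj_mem {P : MvPowerSeries (Fin 2) ℂ} (h : ∀ k j, coeff (e2 k j) P ≠ 0 → S 0 k j) :
    liftConj P ∈ SuppIn S := by
  intro k l n hn
  rw [coeff_liftConj] at hn
  split_ifs at hn with hl
  · subst hl; exact h l n (by simpa using hn)
  · exact absurd rfl hn

/-- The part of `G` that does not depend on `z` and has real coefficients. -/
def realPart (G : MvPowerSeries (Fin 2) ℂ) : MvPowerSeries (Fin 2) ℂ :=
  fun d => if d 0 = 0 then ((coeff d G).re : ℂ) else 0

theorem coeff_realPart (G : MvPowerSeries (Fin 2) ℂ) (k j : ℕ) :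
    coeff (e2 k j) (realPart G) = if k = 0 then ((coeff (e2 k j) G).re : ℂ) else 0 := rfl

theorem conjSeries_realPart (G : MvPowerSeries (Fin 2) ℂ) :
    conjSeries (realPart G) = realPart G := by
  ext d
  rw [← e2_eta d, coeff_conjSeries, coeff_realPart]
  split_ifs <;> simp

/-- The remaining part of `G`. -/
def restPart (G : MvPowerSeries (Fin 2) ℂ) : MvPowerSeries (Fin 2) ℂ := G - realPart G

theorem coeff_restPart_of_pos (G : MvPowerSeries (Fin 2) ℂ) {k : ℕ} (hk : k ≠ 0) (j : ℕ) :
    coeff (e2 k j) (restPart G) = coeff (e2 k j) G := by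
  rw [restPart, map_sub, coeff_realPart, if_neg hk, sub_zero]

/-! ### Linear substitutions -/

/-- The exponents of bidegree at most `e` in `z`, `\bar z`. -/
def Zset (e k l _n : ℕ) : Prop := k + l ≤ e

theorem mul_mem_Z {e e' : ℕ} {f g : MvPowerSeries (Fin 3) ℂ} (hf : f ∈ SuppIn (Zset e))
    (hg : g ∈ SuppIn (Zset e')) : f * g ∈ SuppIn (Zset (e + e')) :=
  mul_mem_suppIn hf hg fun _ _ _ _ _ _ h h' => by unfold Zset at *; omega

theorem pow_mem_Z {e : ℕ} {f : MvPowerSeries (Fin 3) ℂ} (hf : f ∈ SuppIn (Zset e)) (k : ℕ) :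
    f ^ k ∈ SuppIn (Zset (k * e)) := by
  induction k with
  | zero => exact one_mem_suppIn (by unfold Zset; omega)
  | succ k ih => simpa only [pow_succ, Nat.succ_mul] using mul_mem_Z ih hf

/-- The exponents of bidegree less than `e` in `z`, `\bar z`. -/
def Zset' (e k l _n : ℕ) : Prop := k + l < e

theorem mul_mem_Z' {e e' : ℕ} {f g : MvPowerSeries (Fin 3) ℂ} (hf : f ∈ SuppIn (Zset' e))
    (hg : g ∈ SuppIn (Zset e')) : f * g ∈ SuppIn (Zset' (e + e')) :=
  mul_mem_suppIn hf hg fun _ _ _ _ _ _ h h' => by unfold Zset Zset' at *; omega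

theorem pow_sub_pow_mem_Z {f g : MvPowerSeries (Fin 3) ℂ} (hf : f ∈ SuppIn (Zset 1))
    (hg : g ∈ SuppIn (Zset 1)) (h : f - g ∈ SuppIn (Zset' 1)) (k : ℕ) :
    f ^ k - g ^ k ∈ SuppIn (Zset' k) := by
  induction k with
  | zero => simp
  | succ k ih =>
    have : f ^ (k + 1) - g ^ (k + 1) = (f ^ k - g ^ k) * f + (f - g) * g ^ k := by ring
    rw [this]
    refine add_mem (mul_mem_Z' ih hf) ?_
    have := mul_mem_Z' h (pow_mem_Z hg k)
    rwa [mul_one, add_comm] at this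

theorem coeff_subst_diag (a b c : ℂ) (P : MvPowerSeries (Fin 3) ℂ) (k l n : ℕ) :
    coeff (e3 k l n) (subst ![C a * X 0, C b * X 1, C c * (X 2 : MvPowerSeries (Fin 3) ℂ)] P) =
      a ^ k * b ^ l * c ^ n * coeff (e3 k l n) P := by
  have hs : HasSubst ![C a * X 0, C b * X 1, C c * (X 2 : MvPowerSeries (Fin 3) ℂ)] :=
    hasSubst3 (C_mul_mem X0_mem_D a) (C_mul_mem X1_mem_D b) (C_mul_mem X2_mem_D c)
  have hmon : ∀ k' l' n' : ℕ, (C a * X 0) ^ k' * (C b * X 1) ^ l' *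
      (C c * (X 2 : MvPowerSeries (Fin 3) ℂ)) ^ n' =
      C (a ^ k' * b ^ l' * c ^ n') * (X 0 ^ k' * X 1 ^ l' * X 2 ^ n') := by
    intro k' l' n'; simp only [map_mul, map_pow]; ring
  rw [coeff_subst hs, finsum_eq_single _ (e3 k l n)]
  · rw [e3_prod]
    simp only [Matrix.cons_val]
    rw [hmon, coeff_C_mul, coeff_X_pow, if_pos ⟨rfl, rfl, rfl⟩, smul_eq_mul]; ring
  · intro d hd
    rw [← e3_eta d] at hd ⊢
    rw [Ne, e3_inj] at hd
    rw [e3_prod]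
    simp only [Matrix.cons_val]
    rw [hmon, coeff_C_mul, coeff_X_pow, if_neg (by omega), mul_zero, smul_zero]

/-- Under the linear substitution `z ↦ a z + a' u`, `\bar z ↦ b \bar z + b' u`, `u ↦ c u`, the
coefficients of highest bidegree are multiplied by powers of `a`, `b`, `c`. -/
theorem coeff_subst_linear (a a' b b' c : ℂ) {P : MvPowerSeries (Fin 3) ℂ} {k l n : ℕ}
    (hP : P ∈ SuppIn (Zset (k + l))) :
    coeff (e3 k l n) (subst ![C a * X 0 + C a' * X 2, C b * X 1 + C b' * X 2,
      C c * (X 2 : MvPowerSeries (Fin 3) ℂ)] P) = a ^ k * b ^ l * c ^ n * coeff (e3 k l n) P := by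
  have hs : HasSubst ![C a * X 0, C b * X 1, C c * (X 2 : MvPowerSeries (Fin 3) ℂ)] :=
    hasSubst3 (C_mul_mem X0_mem_D a) (C_mul_mem X1_mem_D b) (C_mul_mem X2_mem_D c)
  have hs' : HasSubst ![C a * X 0 + C a' * X 2, C b * X 1 + C b' * X 2,
      C c * (X 2 : MvPowerSeries (Fin 3) ℂ)] :=
    hasSubst3 (linear_mem_D _ _ _ _) (linear_mem_D _ _ _ _) (C_mul_mem X2_mem_D c)
  rw [← coeff_subst_diag]
  have h0 : (X 0 : MvPowerSeries (Fin 3) ℂ) ∈ SuppIn (Zset 1) := X0_mem (by unfold Zset; omega)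
  have h1 : (X 1 : MvPowerSeries (Fin 3) ℂ) ∈ SuppIn (Zset 1) := X1_mem (by unfold Zset; omega)
  have h2 : (X 2 : MvPowerSeries (Fin 3) ℂ) ∈ SuppIn (Zset 1) := X2_mem (by unfold Zset; omega)
  have h2' : (X 2 : MvPowerSeries (Fin 3) ℂ) ∈ SuppIn (Zset 0) := X2_mem (by unfold Zset; omega)
  have h3 : (X 2 : MvPowerSeries (Fin 3) ℂ) ∈ SuppIn (Zset' 1) := X2_mem (by unfold Zset'; omega)
  -- Each use of a' u or b' u in place of a z or b \bar z lowers the bidegree, and no monomial of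
  -- `P` has bidegree above k + l, so these terms miss the coefficient in question.
  refine coeff_eq_of_sub_mem (S := Zset' (k + l)) (subst3_sub_mem hs' hs fun k' l' n' hn => ?_)
    (by unfold Zset'; omega)
  have hkl : k' + l' ≤ k + l := hP k' l' n' hn
  have e1 := pow_sub_pow_mem_Z (add_mem (C_mul_mem h0 a) (C_mul_mem h2 a')) (C_mul_mem h0 a)
    (by rw [add_sub_cancel_left]; exact C_mul_mem h3 a') k'
  have e2 := pow_sub_pow_mem_Z (add_mem (C_mul_mem h1 b) (C_mul_mem h2 b')) (C_mul_mem h1 b)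
    (by rw [add_sub_cancel_left]; exact C_mul_mem h3 b') l'
  have p2 := pow_mem_Z (add_mem (C_mul_mem h1 b) (C_mul_mem h2 b')) l'
  have p1 := pow_mem_Z (C_mul_mem h0 a) k'
  have p3 := pow_mem_Z (C_mul_mem h2' c) n'
  have e : (C a * X 0 + C a' * X 2) ^ k' * (C b * X 1 + C b' * X 2) ^ l' * (C c * X 2) ^ n' -
      (C a * X 0) ^ k' * (C b * X 1) ^ l' * (C c * (X 2 : MvPowerSeries (Fin 3) ℂ)) ^ n' =
      (((C a * X 0 + C a' * X 2) ^ k' - (C a * X 0) ^ k') * (C b * X 1 + C b' * X 2) ^ l' +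
      ((C b * X 1 + C b' * X 2) ^ l' - (C b * X 1) ^ l') * (C a * X 0) ^ k') *
        (C c * (X 2 : MvPowerSeries (Fin 3) ℂ)) ^ n' := by
    ring
  rw [e]
  have m1 := mul_mem_Z' e1 p2
  have m2 := mul_mem_Z' e2 p1
  rw [mul_one] at m1 m2
  rw [add_comm l' k'] at m2
  refine suppIn_mono (mul_mem_Z' (add_mem m1 m2) p3) fun _ _ _ h => ?_
  unfold Zset' at *; omega

end FuchsianInvariance

end

/-! ### The induction hypothesis and its base case. -/

noncomputable section

namespace FuchsianInvariance

open MvPowerSeries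

variable {S S' U : ℕ → ℕ → ℕ → Prop} {A A' : AdmissibleForm} {F G : MvPowerSeries (Fin 2) ℂ}

/-- The two equations and the map between them look as for equations of Fuchsian type, up to
total degree `N` of the equations. -/
structure FuchsianUpTo (A A' : AdmissibleForm) (F G : MvPowerSeries (Fin 2) ℂ) (N : ℕ) : Prop where
  source : A.higherTerms ∈ SuppIn (Kset A.m N 0)
  target : A'.higherTerms ∈ SuppIn (Kset A.m N 0)
  F_mem : ∀ k j, coeff (e2 k j) F ≠ 0 → Tset A.m N 1 0 1 k 0 j
  G_mem : ∀ k j, coeff (e2 k j) (restPart G) ≠ 0 → Tset A.m N 1 0 (A.m + 2) k 0 j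

theorem Kset_add_iff {m N e k l n : ℕ} : Kset m N e k l (n + e) ↔ Kset m N 0 k l n := by
  unfold Kset Tset; omega

theorem mem_K_of_mem_D {m N e d : ℕ} {f : MvPowerSeries (Fin 3) ℂ} (hf : f ∈ SuppIn (Dset d))
    (h : e + N ≤ d) : f ∈ SuppIn (Kset m N e) :=
  suppIn_mono hf fun _ _ _ h' => by unfold Dset at h'; unfold Kset Tset; omega

/-- For N = 2 the last clause of `Tset` admits every degree from e on. Only the condition on G has
content: the right-hand side of the mapping identity has order at least m + 2, so below that degree
G has no terms containing z, and its pure w-terms are real. -/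
theorem FormalMap.fuchsianUpTo_two (h : FormalMap A A' F G) : FuchsianUpTo A A' F G 2 := by
  have h4 : ∀ B : AdmissibleForm, B.higherTerms ∈ SuppIn (Dset 4) := fun B =>
    suppIn_mono (higherTerms_mem B) fun k l n h => by unfold Dset; omega
  refine ⟨mem_K_of_mem_D (h4 A) (by omega), mem_K_of_mem_D (h4 A') (by omega), ?_, ?_⟩
  · intro k j hkj
    have : 1 ≤ k + j := by
      by_contra h0
      obtain ⟨rfl, rfl⟩ : k = 0 ∧ j = 0 := by omega
      exact hkj h.F_zero
    unfold Tset; omega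
  · intro k j hkj
    suffices A.m + 2 ≤ k + j by unfold Tset; omega
    by_contra hlt
    apply hkj
    have hR := C_mul_mem (mul_mem_D (pow_mem_D h.t_mem_D A'.m) h.rhs_mem_D) Complex.I
    rw [← h.eqn, ← h.m_eq] at hR
    have := coeff_eq_of_sub_mem hR (k := k) (l := 0) (n := j) (by unfold Dset; omega)
    rw [coeff_pullback_of_eq_zero A G (by omega),
      coeff_pullbackConj_of_eq_zero A G (by omega), if_pos rfl] at this
    rw [restPart, map_sub, coeff_realPart, this]
    split_ifs with hk
    · subst hk
      rw [if_pos rfl] at this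
      have him : (coeff (e2 0 j) G).im = 0 := Complex.conj_eq_iff_im.1 this.symm
      rw [sub_eq_zero]
      apply Complex.ext <;> simp [him]
    · simp

/-! ### Pullbacks and exponent sets -/

section

variable {m N p q e : ℕ}

theorem pullback_mem_T (h2 : 2 ≤ N) (hN : N ≤ 2 * m + 5) {P : MvPowerSeries (Fin 2) ℂ}
    (hw : A.wSeries ∈ SuppIn (Tset m N 0 0 1))
    (hP : ∀ k j, coeff (e2 k j) P ≠ 0 → Tset m N p q e k 0 j) :
    A.pullback P ∈ SuppIn (Tset m N p q e) := by
  refine subst2_mem (hasSubst_wSeries A) fun k j hkj => ?_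
  have := monomial_mem_T h2 hN (X0_mem (by unfold Tset; omega)) (X1_mem (by unfold Tset; omega))
    hw k 0 j
  rw [pow_zero, mul_one] at this
  exact suppIn_mono this fun _ _ _ h' => (hP k j hkj).trans h2 hN h'

theorem pullbackConj_mem_T (h2 : 2 ≤ N) (hN : N ≤ 2 * m + 5) {P : MvPowerSeries (Fin 2) ℂ}
    (hw : A.wConjSeries ∈ SuppIn (Tset m N 0 0 1))
    (hP : ∀ k j, coeff (e2 k j) P ≠ 0 → Tset m N p q e k 0 j) :
    A.pullbackConj P ∈ SuppIn (Tset m N q p e) := by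
  refine subst2_mem (hasSubst_wConjSeries A) fun k j hkj => ?_
  replace hkj := coeff_conjSeries_ne_zero hkj
  have := monomial_mem_T h2 hN (X0_mem (by unfold Tset; omega)) (X1_mem (by unfold Tset; omega))
    hw 0 k j
  rw [pow_zero, one_mul] at this
  exact suppIn_mono this fun _ _ _ h' => (hP k j hkj).swap.trans h2 hN h'

/-- Applied to w and \bar w, this isolates the factor w - \bar w = i u^m H and keeps the cofactor
under control. -/
theorem exists_pow_sub_pow_eq (h2 : 2 ≤ N) (hN : N ≤ 2 * m + 5) {f g : MvPowerSeries (Fin 3) ℂ}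
    (hf : f ∈ SuppIn (Tset m N 0 0 1)) (hg : g ∈ SuppIn (Tset m N 0 0 1)) (j : ℕ) :
    ∃ q ∈ SuppIn (Tset m N 0 0 j), f ^ (j + 1) - g ^ (j + 1) = (f - g) * q := by
  induction j with
  | zero => exact ⟨1, one_mem_suppIn (by unfold Tset; omega), by ring⟩
  | succ j ih =>
    obtain ⟨q, hq, e⟩ := ih
    refine ⟨q * f + g ^ (j + 1), add_mem (mul_mem_T h2 hN hq hf) ?_, ?_⟩
    · simpa using pow_mem_T h2 hN hg (j + 1)
    · linear_combination f * e

end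

end FuchsianInvariance

end

/-! ### The homological equation for the first deviations. -/

noncomputable section

namespace FuchsianInvariance

open MvPowerSeries

variable {S S' U : ℕ → ℕ → ℕ → Prop} {A A' : AdmissibleForm} {F G : MvPowerSeries (Fin 2) ℂ}
  {m N : ℕ}

theorem FormalMap.coeff_realPart_one (h : FormalMap A A' F G) :
    coeff (e2 0 1) (realPart G) = coeff (e2 0 1) G := by
  rw [coeff_realPart, if_pos rfl]
  exact Complex.conj_eq_iff_re.1 h.conj_coeff_G

/-- The part of `F` that is not admitted in the next step. -/
def badF (m N : ℕ) (F : MvPowerSeries (Fin 2) ℂ) : MvPowerSeries (Fin 2) ℂ :=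
  part2 (fun k j => ¬ Tset m (N + 1) 1 0 1 k 0 j) F

/-- The part of `G` that is not admitted in the next step. -/
def badG (m N : ℕ) (G : MvPowerSeries (Fin 2) ℂ) : MvPowerSeries (Fin 2) ℂ :=
  part2 (fun k j => ¬ Tset m (N + 1) 1 0 (m + 2) k 0 j) (restPart G)

/-- The part of the right-hand side of an admissible equation that is not admitted in the next
step. -/
def badH (m N : ℕ) (A : AdmissibleForm) : MvPowerSeries (Fin 3) ℂ :=
  part3 (fun k l n => ¬ Kset m (N + 1) 0 k l n) A.higherTerms

theorem badH_eq_zero_iff : badH m N A = 0 ↔ A.higherTerms ∈ SuppIn (Kset m (N + 1) 0) := by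
  constructor
  · intro h0 k l n hn
    by_contra hK
    apply hn
    have := coeff_part3 (fun k l n => ¬ Kset m (N + 1) 0 k l n) A.higherTerms k l n
    rw [if_pos hK] at this
    rw [← this]
    change coeff _ (badH m N A) = 0
    rw [h0, map_zero]
  · intro h
    ext d
    rw [← e3_eta d]
    change coeff _ (badH m N A) = 0
    by_contra hne
    have := of_coeff_part3_ne_zero hne
    exact this.1 (h _ _ _ this.2)

theorem sub_badH_mem : A.higherTerms - badH m N A ∈
    SuppIn fun k l n => Kset m (N + 1) 0 k l n ∧ 2 ≤ k ∧ 2 ≤ l := by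
  intro k l n hn
  have := of_coeff_sub_part3_ne_zero hn
  exact ⟨not_not.1 this.1, higherTerms_mem A k l n this.2⟩

/-- Passing from N to N + 1 shrinks `Kset` only through its last clause, so what is lost is
homogeneous of degree N. -/
theorem badH_mem (hA : A.higherTerms ∈ SuppIn (Kset m N 0)) : badH m N A ∈
    SuppIn fun k l n => ¬ Kset m (N + 1) 0 k l n ∧ 2 ≤ k ∧ 2 ≤ l ∧ k + l + n = N := by
  intro k l n hn
  have h1 := of_coeff_part3_ne_zero hn
  have h2 := hA k l n h1.2
  have h3 := higherTerms_mem A k l n h1.2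
  refine ⟨h1.1, h3.1, h3.2, ?_⟩
  have h4 := h1.1
  unfold Kset Tset at *; omega

theorem reducedSeries_sub_badH_mem :
    reducedSeries A - badH m N A ∈ SuppIn (Kset m (N + 1) 0) := by
  rw [reducedSeries, add_sub_assoc]
  refine add_mem (leading_mem A ?_) (suppIn_mono sub_badH_mem fun _ _ _ h => h.1)
  unfold Kset Tset; omega

namespace FuchsianUpTo

variable (g : FuchsianUpTo A A' F G N) (h : FormalMap A A' F G) (h2 : 2 ≤ N)
  (hN : N ≤ 2 * A.m + 4)

include g

/-- As for H, only the last clause changes, and for F it starts at degree N - 1. In the mapping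
identity the deviation of F is multiplied by u^m and a linear factor, so it enters in degree m + N,
like u^m times that of H and like that of G. -/
theorem of_badF {k j : ℕ} (hkj : coeff (e2 k j) (badF A.m N F) ≠ 0) :
    ¬ Tset A.m (N + 1) 1 0 1 k 0 j ∧ k + j + 1 = N ∧ coeff (e2 k j) F ≠ 0 := by
  have h1 := of_coeff_part2_ne_zero hkj
  have h3 := g.F_mem k j h1.2
  refine ⟨h1.1, ?_, h1.2⟩
  have h4 := h1.1
  unfold Tset at *; omega

theorem of_badG {k j : ℕ} (hkj : coeff (e2 k j) (badG A.m N G) ≠ 0) :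
    ¬ Tset A.m (N + 1) 1 0 (A.m + 2) k 0 j ∧ k + j = A.m + N := by
  have h1 := of_coeff_part2_ne_zero hkj
  have h3 := g.G_mem k j h1.2
  refine ⟨h1.1, ?_⟩
  have h4 := h1.1
  unfold Tset at *; omega

theorem redSeries_mem : reducedSeries A ∈ SuppIn (Kset A.m N 0) :=
  add_mem (leading_mem A (by unfold Kset Tset; omega)) g.source

include h2 hN

omit h2 in
-- The gains in `Tset` originate here: u^m z \bar z has degree 1 + (m + 1), and u^m times a term of
-- bidegree at most (2, 2) and degree at least m + 3 has degree at least 1 + (2m + 2). Owing to the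
-- factor u^m, knowing H up to N suffices for w up to N + 1.
theorem w_sub_mem : X 2 ^ A.m * reducedSeries A ∈ SuppIn (Tset A.m (N + 1) 0 0 1) := by
  have hm := A.one_le_m
  refine mul_mem_suppIn (S := fun k l n => k = 0 ∧ l = 0 ∧ n = A.m) (X2_pow_mem (by omega))
    g.redSeries_mem fun _ _ _ _ _ _ h h' => by unfold Kset Tset at *; omega

omit h2 in
theorem w_mem : A.wSeries ∈ SuppIn (Tset A.m (N + 1) 0 0 1) := by
  rw [wSeries_eq]
  exact add_mem (X2_mem (by unfold Tset; omega)) (C_mul_mem (g.w_sub_mem hN) _)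

omit h2 in
theorem wConj_mem : A.wConjSeries ∈ SuppIn (Tset A.m (N + 1) 0 0 1) := by
  rw [wConjSeries_eq]
  exact sub_mem (X2_mem (by unfold Tset; omega)) (C_mul_mem (g.w_sub_mem hN) _)

include h

theorem t_mem : rePullback A G ∈ SuppIn (Tset A.m (N + 1) 0 0 1) := by
  have hm := A.one_le_m
  have hG : ∀ k j, coeff (e2 k j) G ≠ 0 → Tset A.m (N + 1) 0 0 1 k 0 j := by
    intro k j hkj
    rcases Nat.eq_zero_or_pos k with rfl | hk
    · have : j ≠ 0 := by rintro rfl; exact hkj h.G_zero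
      unfold Tset; omega
    · rw [← coeff_restPart_of_pos G (by omega)] at hkj
      have := g.G_mem k j hkj
      unfold Tset at *; omega
  exact C_mul_mem (add_mem (pullback_mem_T (by omega) (by omega) (g.w_mem hN) hG)
    (pullbackConj_mem_T (by omega) (by omega) (g.wConj_mem hN) hG)) _

omit h

/-- The deviation of F has degree N - 1; replacing w by u in it changes only terms of degree at
least m + N, all admitted. -/
theorem x_sub_mem : A.pullback F - lift (badF A.m N F) ∈ SuppIn (Tset A.m (N + 1) 1 0 1) := by
  have e : A.pullback F - lift (badF A.m N F) = A.pullback (F - badF A.m N F) +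
      (A.pullback (badF A.m N F) - lift (badF A.m N F)) := by rw [pullback_sub]; ring
  rw [e]
  refine add_mem (pullback_mem_T (by omega) (by omega) (g.w_mem hN) fun k j hkj =>
    not_not.1 (of_coeff_sub_part2_ne_zero hkj).1) ?_
  refine pullback_sub_mem A fun k j hkj _ k' l' n' _ _ _ _ => ?_
  have := (g.of_badF hkj).2.1
  have := A.one_le_m
  unfold Tset; omega

theorem y_sub_mem :
    A.pullbackConj F - liftConj (badF A.m N F) ∈ SuppIn (Tset A.m (N + 1) 0 1 1) := by
  have e : A.pullbackConj F - liftConj (badF A.m N F) = A.pullbackConj (F - badF A.m N F) +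
      (A.pullbackConj (badF A.m N F) - liftConj (badF A.m N F)) := by rw [pullbackConj_sub]; ring
  rw [e]
  refine add_mem (pullbackConj_mem_T (by omega) (by omega) (g.wConj_mem hN) fun k j hkj =>
    not_not.1 (of_coeff_sub_part2_ne_zero hkj).1) ?_
  refine pullbackConj_sub_mem A fun k j hkj _ k' l' n' _ _ _ _ => ?_
  have := (g.of_badF hkj).2.1
  have := A.one_le_m
  unfold Tset; omega

omit h2 hN

theorem two_le_of_badF {k j : ℕ} (hkj : coeff (e2 k j) (badF A.m N F) ≠ 0)
    (hF : coeff (e2 0 0) F = 0) : 2 ≤ k := by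
  obtain ⟨h1, h3, h4⟩ := g.of_badF hkj
  by_contra hk
  rcases Nat.eq_zero_or_pos (k + j) with h0 | h0
  · obtain ⟨rfl, rfl⟩ : k = 0 ∧ j = 0 := by omega
    exact h4 hF
  · unfold Tset at h1; omega

theorem lift_badF_mem (h : FormalMap A A' F G) {d : ℕ} (hd : d + 1 ≤ N ∨ d ≤ 2) :
    lift (badF A.m N F) ∈ SuppIn (Dset d) :=
  lift_mem fun k j hkj => by
    have h1 := (g.of_badF hkj).2.1
    have h2 := g.two_le_of_badF hkj h.F_zero
    unfold Dset; omega

theorem liftConj_badF_mem (h : FormalMap A A' F G) {d : ℕ} (hd : d + 1 ≤ N ∨ d ≤ 2) :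
    liftConj (badF A.m N F) ∈ SuppIn (Dset d) :=
  liftConj_mem fun k j hkj => by
    have h1 := (g.of_badF hkj).2.1
    have h2 := g.two_le_of_badF hkj h.F_zero
    unfold Dset; omega

end FuchsianUpTo

/-- The linear part of `F`, restricted to `w = u`. -/
def linF (F : MvPowerSeries (Fin 2) ℂ) : MvPowerSeries (Fin 3) ℂ :=
  C (coeff (e2 1 0) F) * X 0 + C (coeff (e2 0 1) F) * X 2

/-- The linear part of `\bar F`, restricted to `w = u`. -/
def linFConj (F : MvPowerSeries (Fin 2) ℂ) : MvPowerSeries (Fin 3) ℂ :=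
  C (conj (coeff (e2 1 0) F)) * X 1 + C (conj (coeff (e2 0 1) F)) * X 2

/-- The effect of the linear part of the map on the leading bad part of the target. -/
def linH (m N : ℕ) (F G : MvPowerSeries (Fin 2) ℂ) (A' : AdmissibleForm) :
    MvPowerSeries (Fin 3) ℂ :=
  subst ![linF F, linFConj F, C (coeff (e2 0 1) G) * X 2] (badH m N A')

/-- The effect of the bad part of `F` on the leading term of the target. -/
def crossF (m N : ℕ) (F : MvPowerSeries (Fin 2) ℂ) : MvPowerSeries (Fin 3) ℂ :=
  lift (badF m N F) * linFConj F + liftConj (badF m N F) * linF F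

namespace FuchsianUpTo

variable (g : FuchsianUpTo A A' F G N) (h : FormalMap A A' F G) (h2 : 2 ≤ N)
  (hN : N ≤ 2 * A.m + 4)
include g h

theorem crossF_mem : crossF A.m N F ∈ SuppIn (Dset N) := by
  refine add_mem (mem_D_mono (mul_mem_D (g.lift_badF_mem h (d := N - 1) (by omega))
    (linear_mem_D _ _ _ _)) (by omega)) (mem_D_mono (mul_mem_D (g.liftConj_badF_mem h
    (d := N - 1) (by omega)) (linear_mem_D _ _ _ _)) (by omega))

omit g h in
theorem hasSubst_lin : HasSubst ![linF F, linFConj F, C (coeff (e2 0 1) G) * X 2] :=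
  hasSubst3 (linear_mem_D _ _ _ _) (linear_mem_D _ _ _ _) (C_mul_mem X2_mem_D _)

omit h in
theorem linH_mem : linH A.m N F G A' ∈ SuppIn (Dset N) := by
  refine subst3_mem hasSubst_lin fun k l n hn => ?_
  have := badH_mem g.target k l n hn
  exact mem_D_mono (mul_mem_D (mul_mem_D (pow_mem_D (linear_mem_D _ _ _ _) k)
    (pow_mem_D (linear_mem_D _ _ _ _) l)) (pow_mem_D (C_mul_mem X2_mem_D _) n)) (by omega)

include h2 hN

/-- The product of the admitted parts of F and \bar F is admitted. A deviation has degree N - 1,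
hence reaches degree N only against the linear part of the other factor. -/
theorem xy_sub_mem : A.pullback F * A.pullbackConj F - crossF A.m N F ∈
    SuppIn (Kset A.m (N + 1) 0) := by
  set f := lift (badF A.m N F) with hf
  set f' := liftConj (badF A.m N F) with hf'
  have hx := g.x_sub_mem h2 hN
  have hy := g.y_sub_mem h2 hN
  rw [← hf] at hx
  rw [← hf'] at hy
  have hlx : A.pullback F - f - linF F ∈ SuppIn (Dset 2) := by
    rw [sub_right_comm]
    exact sub_mem (pullback_sub_linear_mem A h.F_zero) (g.lift_badF_mem h (by omega))
  have hly : A.pullbackConj F - f' - linFConj F ∈ SuppIn (Dset 2) := by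
    rw [sub_right_comm]
    exact sub_mem (pullbackConj_sub_linear_mem A h.F_zero) (g.liftConj_badF_mem h (by omega))
  have e : A.pullback F * A.pullbackConj F - crossF A.m N F =
      (A.pullback F - f) * (A.pullbackConj F - f') + (f * (A.pullbackConj F - f' - linFConj F) +
        f' * (A.pullback F - f - linF F) + f * f') := by
    rw [crossF]; ring
  rw [e]
  refine add_mem (suppIn_mono (mul_mem_T (by omega) (by omega) hx hy) fun _ _ _ h' => Or.inl h') ?_
  refine mem_K_of_mem_D (d := N + 1) (add_mem (add_mem ?_ ?_) ?_) (by omega)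
  · exact mem_D_mono (mul_mem_D (g.lift_badF_mem h (d := N - 1) (by omega)) hly) (by omega)
  · exact mem_D_mono (mul_mem_D (g.liftConj_badF_mem h (d := N - 1) (by omega)) hlx) (by omega)
  · exact mem_D_mono (mul_mem_D (g.lift_badF_mem h (d := N - 1) (by omega))
      (g.liftConj_badF_mem h (d := 2) (by omega))) (by omega)

/-- Three effects are separated. In the admitted part of H', whose monomials have degree at least 4,
the deviation of F matters only beyond degree N. After its removal `Kset.trans` applies. In the
deviation of H', homogeneous of degree N, only the linear part of the map matters. -/
theorem higher_sub_mem :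
    subst ![A.pullback F, A.pullbackConj F, rePullback A G] A'.higherTerms - linH A.m N F G A' ∈
      SuppIn (Kset A.m (N + 1) 0) := by
  have hm := A.one_le_m
  set f := lift (badF A.m N F) with hf
  set f' := liftConj (badF A.m N F) with hf'
  have hfD : f ∈ SuppIn (Dset 1) := g.lift_badF_mem h (by omega)
  have hfD' : f' ∈ SuppIn (Dset 1) := g.liftConj_badF_mem h (by omega)
  have hs' : HasSubst ![A.pullback F - f, A.pullbackConj F - f', rePullback A G] :=
    hasSubst3 (sub_mem h.x_mem_D hfD) (sub_mem h.y_mem_D hfD') h.t_mem_D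
  have e : subst ![A.pullback F, A.pullbackConj F, rePullback A G] A'.higherTerms -
      linH A.m N F G A' =
      (subst ![A.pullback F, A.pullbackConj F, rePullback A G] (A'.higherTerms - badH A.m N A') -
        subst ![A.pullback F - f, A.pullbackConj F - f', rePullback A G]
          (A'.higherTerms - badH A.m N A')) +
      subst ![A.pullback F - f, A.pullbackConj F - f', rePullback A G]
          (A'.higherTerms - badH A.m N A') +
      (subst ![A.pullback F, A.pullbackConj F, rePullback A G] (badH A.m N A') -
        linH A.m N F G A') := by
    rw [subst_sub h.hasSubst]; ring
  rw [e]
  refine add_mem (add_mem ?_ ?_) ?_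
  · refine mem_K_of_mem_D (d := N + 1) (subst3_sub_mem h.hasSubst hs' fun k l n hn => ?_) (by omega)
    have := sub_badH_mem k l n hn
    refine mem_D_mono (monomial_sub_mem_D (e := N - 2) h.x_mem_D (sub_mem h.x_mem_D hfD) ?_
      h.y_mem_D (sub_mem h.y_mem_D hfD') ?_ h.t_mem_D h.t_mem_D ?_ k l n) (by omega)
    · rw [sub_sub_cancel]; exact g.lift_badF_mem h (by omega)
    · rw [sub_sub_cancel]; exact g.liftConj_badF_mem h (by omega)
    · rw [sub_self]; exact zero_mem _
  · refine subst3_mem hs' fun k l n hn => ?_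
    have hK := (sub_badH_mem k l n hn).1
    exact suppIn_mono (monomial_mem_T (by omega) (by omega) (g.x_sub_mem h2 hN)
      (g.y_sub_mem h2 hN) (g.t_mem h h2 hN) k l n) fun _ _ _ h' =>
      hK.trans hm (by omega) (by omega) h'
  · refine mem_K_of_mem_D (d := N + 1) (subst3_sub_mem h.hasSubst hasSubst_lin
      fun k l n hn => ?_) (by omega)
    have := badH_mem g.target k l n hn
    exact mem_D_mono (monomial_sub_mem_D (e := 1) h.x_mem_D (linear_mem_D _ _ _ _)
      (pullback_sub_linear_mem A h.F_zero) h.y_mem_D (linear_mem_D _ _ _ _)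
      (pullbackConj_sub_linear_mem A h.F_zero) h.t_mem_D (C_mul_mem X2_mem_D _)
      h.t_sub_mem_D k l n) (by omega)

/-- The right-hand side of the mapping identity up to admitted terms. -/
theorem rhs_sub_mem :
    rePullback A G ^ A.m *
      subst ![A.pullback F, A.pullbackConj F, rePullback A G] (reducedSeries A') -
    (C (coeff (e2 0 1) G) * X 2) ^ A.m *
      (C (A'.ε : ℂ) * crossF A.m N F + linH A.m N F G A') ∈ SuppIn (Kset A.m (N + 1) A.m) := by
  have hm := A.one_le_m
  set t := rePullback A G
  set E := C (A'.ε : ℂ) * crossF A.m N F + linH A.m N F G A' with hE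
  set R := subst ![A.pullback F, A.pullbackConj F, t] (reducedSeries A') with hR
  have h1 : R - E ∈ SuppIn (Kset A.m (N + 1) 0) := by
    have := add_mem (C_mul_mem (g.xy_sub_mem h h2 hN) (A'.ε : ℂ)) (g.higher_sub_mem h h2 hN)
    convert this using 1
    rw [hR, h.subst_reducedSeries, hE]; ring
  have hED : E ∈ SuppIn (Dset N) := add_mem (C_mul_mem (g.crossF_mem h) _) g.linH_mem
  have e : t ^ A.m * R - (C (coeff (e2 0 1) G) * X 2) ^ A.m * E =
      (R - E) * t ^ A.m + (t ^ A.m - (C (coeff (e2 0 1) G) * X 2) ^ A.m) * E := by ring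
  rw [e]
  refine add_mem ?_ ?_
  · have ht := pow_mem_T (by omega) (by omega) (g.t_mem h h2 hN) A.m
    rw [mul_zero, mul_one] at ht
    have := mul_mem_K hm (by omega) (by omega) h1 ht
    rwa [zero_add] at this
  · refine mem_K_of_mem_D (mul_mem_D (pow_sub_pow_mem_D (e := 1) h.t_mem_D
      (C_mul_mem X2_mem_D _) h.t_sub_mem_D A.m) hED) (by omega)

/-- The contribution of the real part of `G` to the left-hand side, up to admitted terms. -/
theorem realPart_sub_mem :
    A.pullback (realPart G) - A.pullbackConj (realPart G) -
      C (coeff (e2 0 1) G * Complex.I) * (X 2 ^ A.m * badH A.m N A) ∈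
      SuppIn (Kset A.m (N + 1) A.m) := by
  have hm := A.one_le_m
  set c := coeff (e2 0 1) G with hc
  have hcc : coeff (e2 0 1) (realPart G) = c := h.coeff_realPart_one
  -- The linear term cw yields c i u^m H exactly, hence the deviation of H. The remainder `Q`, real
  -- and of order at least 2 in w, yields multiples (w - \bar w) q with q of order at least 1.
  set Q := realPart G - C c * X 1 with hQ
  have hXm : ∀ B ∈ SuppIn (Kset A.m (N + 1) 0), X 2 ^ A.m * B ∈ SuppIn (Kset A.m (N + 1) A.m) := by
    intro B hB
    have := mul_mem_K hm (by omega) (by omega) hB (X2_pow_mem (n := A.m)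
      (S := Tset A.m (N + 1) 0 0 A.m) (by unfold Tset; omega))
    rwa [zero_add, mul_comm] at this
  have hQc : ∀ k j, coeff (e2 k j) Q ≠ 0 → k = 0 ∧ 2 ≤ j := by
    intro k j hkj
    rw [hQ, ← hcc, coeff_sub_C_mul_X] at hkj
    split_ifs at hkj with h'
    · exact absurd rfl hkj
    · rw [coeff_realPart] at hkj
      split_ifs at hkj with hk
      · refine ⟨hk, ?_⟩
        subst hk
        by_contra hj
        obtain rfl : j = 0 := by omega
        rw [h.G_zero] at hkj
        simp at hkj
      · exact absurd rfl hkj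
  have hQQ : A.pullbackConj Q = subst ![(X 1 : MvPowerSeries (Fin 3) ℂ), A.wConjSeries] Q := by
    rw [AdmissibleForm.pullbackConj]
    congr 1
    change conjSeries Q = Q
    have h1 : conjSeries Q = conjSeries (realPart G) - conjSeries (C c * X 1) := map_sub _ _ _
    have h2 : conjSeries (C c * X 1) = C c * X 1 := by
      rw [conjSeries, map_mul, map_C, map_X, h.conj_coeff_G]
    rw [h1, h2, conjSeries_realPart]
  have e : A.pullback (realPart G) - A.pullbackConj (realPart G) -
      C (c * Complex.I) * (X 2 ^ A.m * badH A.m N A) =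
      (A.pullback Q - A.pullbackConj Q) +
        C (c * Complex.I) * (X 2 ^ A.m * (reducedSeries A - badH A.m N A)) := by
    have hw := wSeries_sub_wConjSeries A
    rw [hQ, pullback_sub, pullbackConj_sub, pullback_C_mul_X, pullbackConj_C_mul_X,
      h.conj_coeff_G, map_mul]
    linear_combination (C c) * hw
  rw [e]
  refine add_mem ?_ (C_mul_mem (hXm _ reducedSeries_sub_badH_mem) _)
  rw [hQQ]
  refine subst2_sub_mem (hasSubst_wSeries A) (hasSubst_wConjSeries A) fun k j hkj => ?_
  obtain ⟨rfl, hj⟩ := hQc k j hkj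
  obtain ⟨j, rfl⟩ : ∃ i, j = i + 1 := ⟨j - 1, by omega⟩
  rw [pow_zero, pow_zero, one_mul, one_mul]
  obtain ⟨q, hq, hqe⟩ := exists_pow_sub_pow_eq (by omega) (by omega) (g.w_mem hN)
    (g.wConj_mem hN) j
  rw [hqe, wSeries_sub_wConjSeries, mul_assoc]
  refine C_mul_mem ?_ _
  -- The admitted part of u^m H stays admitted after multiplication by q, while q pushes the
  -- deviation beyond degree m + N.
  have e2 : X 2 ^ A.m * reducedSeries A * q = X 2 ^ A.m * (reducedSeries A - badH A.m N A) * q +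
    X 2 ^ A.m * badH A.m N A * q := by ring
  rw [e2]
  refine add_mem ?_ ?_
  · have := mul_mem_K hm (by omega) (by omega) (hXm _ (reducedSeries_sub_badH_mem (A := A)))
      (suppIn_mono hq (S' := Tset A.m (N + 1) 0 0 0) fun _ _ _ h' => by unfold Tset at *; omega)
    simpa using this
  · have hb : badH A.m N A ∈ SuppIn (Dset N) :=
      suppIn_mono (badH_mem g.source) fun _ _ _ h' => by unfold Dset; omega
    have hq' : q ∈ SuppIn (Dset 1) :=
      suppIn_mono hq fun _ _ _ h' => by unfold Dset; unfold Tset at h'; omega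
    exact mem_K_of_mem_D (mul_mem_D (mul_mem_D (X2_pow_mem (S := Dset A.m)
      (by unfold Dset; omega)) hb) hq') (by omega)

omit h in
theorem rest_sub_mem :
    A.pullback (restPart G) - lift (badG A.m N G) ∈ SuppIn (Kset A.m (N + 1) A.m) := by
  have e : A.pullback (restPart G) - lift (badG A.m N G) =
      A.pullback (restPart G - badG A.m N G) +
      (A.pullback (badG A.m N G) - lift (badG A.m N G)) := by rw [pullback_sub]; ring
  rw [e]
  refine add_mem (suppIn_mono (pullback_mem_T (by omega) (by omega) (g.w_mem hN)
    (p := 1) (q := 0) (e := A.m + 2) fun k j hkj => not_not.1 (of_coeff_sub_part2_ne_zero hkj).1)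
    fun _ _ _ h' => by unfold Kset; unfold Tset at *; omega) ?_
  refine pullback_sub_mem A fun k j hkj _ k' l' n' _ _ _ _ => ?_
  have := (g.of_badG hkj).2
  unfold Kset Tset; omega

omit h in
theorem restConj_sub_mem :
    A.pullbackConj (restPart G) - liftConj (badG A.m N G) ∈ SuppIn (Kset A.m (N + 1) A.m) := by
  have e : A.pullbackConj (restPart G) - liftConj (badG A.m N G) =
      A.pullbackConj (restPart G - badG A.m N G) +
      (A.pullbackConj (badG A.m N G) - liftConj (badG A.m N G)) := by rw [pullbackConj_sub]; ring
  rw [e]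
  refine add_mem (suppIn_mono (pullbackConj_mem_T (by omega) (by omega) (g.wConj_mem hN)
    (p := 1) (q := 0) (e := A.m + 2) fun k j hkj => not_not.1 (of_coeff_sub_part2_ne_zero hkj).1)
    fun _ _ _ h' => by unfold Kset; unfold Tset at *; omega) ?_
  refine pullbackConj_sub_mem A fun k j hkj _ k' l' n' _ _ _ _ => ?_
  have := (g.of_badG hkj).2
  unfold Kset Tset; omega

/-- The homological equation for the bad parts. -/
theorem bad_relation :
    C (coeff (e2 0 1) G * Complex.I) * (X 2 ^ A.m * badH A.m N A) +
      (lift (badG A.m N G) - liftConj (badG A.m N G)) -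
      C (Complex.I * coeff (e2 0 1) G ^ A.m) * (X 2 ^ A.m *
        (C (A'.ε : ℂ) * crossF A.m N F + linH A.m N F G A')) ∈ SuppIn (Kset A.m (N + 1) A.m) := by
  have h1 := g.rest_sub_mem h2 hN
  have h3 := g.restConj_sub_mem h2 hN
  have h4 := g.realPart_sub_mem h h2 hN
  have h5 := C_mul_mem (g.rhs_sub_mem h h2 hN) Complex.I
  have e1 : A.pullback (restPart G) = A.pullback G - A.pullback (realPart G) :=
    pullback_sub A G (realPart G)
  have e2 : A.pullbackConj (restPart G) = A.pullbackConj G - A.pullbackConj (realPart G) :=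
    pullbackConj_sub A G (realPart G)
  rw [e1] at h1
  rw [e2] at h3
  have hq := h.eqn
  rw [← h.m_eq] at hq
  have := add_mem (sub_mem (sub_mem h3 h1) h4) h5
  convert this using 1
  simp only [map_mul, map_pow, mul_pow]
  linear_combination hq

end FuchsianUpTo

end FuchsianInvariance

end

/-! ### Solving the homological equation, and invariance under formal maps. -/

noncomputable section

namespace FuchsianInvariance

open MvPowerSeries

variable {A A' : AdmissibleForm} {F G : MvPowerSeries (Fin 2) ℂ} {N : ℕ}

theorem lift_mem_zero (P : MvPowerSeries (Fin 2) ℂ) :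
    lift P ∈ SuppIn fun _ l _ => l = 0 := lift_mem fun _ _ _ => rfl

theorem liftConj_mem_zero (P : MvPowerSeries (Fin 2) ℂ) :
    liftConj P ∈ SuppIn fun k _ _ => k = 0 := liftConj_mem fun _ _ _ => rfl

theorem linF_mem (F : MvPowerSeries (Fin 2) ℂ) :
    linF F ∈ SuppIn fun k l _ => k ≤ 1 ∧ l = 0 :=
  add_mem (C_mul_mem (X0_mem (by omega)) _) (C_mul_mem (X2_mem (by omega)) _)

theorem linFConj_mem (F : MvPowerSeries (Fin 2) ℂ) :
    linFConj F ∈ SuppIn fun k l _ => k = 0 ∧ l ≤ 1 :=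
  add_mem (C_mul_mem (X1_mem (by omega)) _) (C_mul_mem (X2_mem (by omega)) _)

theorem crossF_mem_le_one (m N : ℕ) (F : MvPowerSeries (Fin 2) ℂ) :
    crossF m N F ∈ SuppIn fun k l _ => k ≤ 1 ∨ l ≤ 1 :=
  add_mem (mul_mem_suppIn (lift_mem_zero _) (linFConj_mem F) fun _ _ _ _ _ _ _ _ => by omega)
    (mul_mem_suppIn (liftConj_mem_zero _) (linF_mem F) fun _ _ _ _ _ _ _ _ => by omega)

namespace FuchsianUpTo

variable (g : FuchsianUpTo A A' F G N) (h : FormalMap A A' F G) (h2 : 2 ≤ N)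
  (hN : N ≤ 2 * A.m + 4)
include g h h2 hN

/-- When both exponents are at least 2, g and \bar g do not contribute because they are pure, nor do
f \bar L and \bar f L because one of their exponents is at most 1. -/
theorem coeff_badH {k l n : ℕ} (hk : 2 ≤ k) (hl : 2 ≤ l)
    (hbad : ¬ Kset A.m (N + 1) 0 k l n) :
    coeff (e2 0 1) G * coeff (e3 k l n) (badH A.m N A) =
      coeff (e2 0 1) G ^ A.m * coeff (e3 k l n) (linH A.m N F G A') := by
  have := coeff_eq_zero_of_mem (g.bad_relation h h2 hN) (k := k) (l := l) (n := n + A.m)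
    (by rwa [Kset_add_iff])
  rw [map_sub, map_add, map_sub, coeff_C_mul, coeff_C_mul, coeff_X2_pow_mul, coeff_X2_pow_mul,
    coeff_lift, coeff_liftConj, if_neg (by omega), if_neg (by omega), map_add, coeff_C_mul,
    coeff_eq_zero_of_mem (crossF_mem_le_one A.m N F) (by omega)] at this
  have e : Complex.I * (coeff (e2 0 1) G * coeff (e3 k l n) (badH A.m N A)) =
      Complex.I * (coeff (e2 0 1) G ^ A.m * coeff (e3 k l n) (linH A.m N F G A')) := by
    linear_combination this
  exact mul_left_cancel₀ Complex.I_ne_zero e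

theorem badH_source_eq_zero (hb : badH A.m N A' = 0) : badH A.m N A = 0 := by
  ext d
  rw [← e3_eta d]
  change coeff _ (badH A.m N A) = 0
  by_contra hne
  have h1 := badH_mem g.source _ _ _ hne
  have h3 := g.coeff_badH h h2 hN h1.2.1 h1.2.2.1 h1.1
  have h4 : linH A.m N F G A' = 0 := by
    rw [linH, hb, ← coe_substAlgHom hasSubst_lin, map_zero]
  rw [h4, LinearMap.map_zero, mul_zero] at h3
  exact mul_ne_zero h.coeff_G_ne_zero hne h3

/-- The linear part L = az + a'u may contain u, so B'(L, \bar L, cu) mixes bidegrees. In the highest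
bidegree that occurs, however, the coefficient is merely multiplied by a^k \bar a^l c^n ≠ 0, and
descending induction on the bidegree applies. -/
theorem badH_target_eq_zero (hb : badH A.m N A = 0) : badH A.m N A' = 0 := by
  -- The number r measures how far k + l may lie below N + 1; for r = 0 the bidegree exceeds the
  -- degree N of the deviation.
  have key : ∀ r k l n : ℕ, N + 1 ≤ k + l + r → coeff (e3 k l n) (badH A.m N A') = 0 := by
    intro r
    induction r with
    | zero =>
      intro k l n hr
      exact coeff_eq_zero_of_mem (badH_mem g.target) (by omega)
    | succ r ih =>
      intro k l n hr
      by_contra hne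
      have h1 := badH_mem g.target _ _ _ hne
      have h3 := g.coeff_badH h h2 hN h1.2.1 h1.2.2.1 h1.1
      have hZ : badH A.m N A' ∈ SuppIn (Zset (k + l)) := by
        intro k' l' n' hn'
        unfold Zset
        by_contra hlt
        exact hn' (ih k' l' n' (by omega))
      have h4 : coeff (e3 k l n) (linH A.m N F G A') = _ := coeff_subst_linear _ _ _ _ _ hZ
      rw [hb, map_zero, mul_zero, h4] at h3
      have hc : conj (coeff (e2 1 0) F) ≠ 0 := by simpa using h.coeff_F_ne_zero
      exact mul_ne_zero (pow_ne_zero _ h.coeff_G_ne_zero) (mul_ne_zero (mul_ne_zero (mul_ne_zero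
        (pow_ne_zero _ h.coeff_F_ne_zero) (pow_ne_zero _ hc)) (pow_ne_zero _ h.coeff_G_ne_zero))
        hne) h3.symm
  ext d
  rw [← e3_eta d]
  exact key (N + 1) _ _ _ (by omega)

/-- The homological equation when the bad parts of both equations vanish. -/
theorem bad_relation_of_eq_zero (hA : badH A.m N A = 0) (hA' : badH A.m N A' = 0) :
    (lift (badG A.m N G) - liftConj (badG A.m N G)) -
      C (Complex.I * coeff (e2 0 1) G ^ A.m) * (X 2 ^ A.m *
        (C (A'.ε : ℂ) * crossF A.m N F)) ∈ SuppIn (Kset A.m (N + 1) A.m) := by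
  have := g.bad_relation h h2 hN
  have h4 : linH A.m N F G A' = 0 := by
    rw [linH, hA', ← coe_substAlgHom hasSubst_lin, map_zero]
  rwa [hA, h4, mul_zero, mul_zero, zero_add, add_zero] at this

/-- In the coefficient of z^k \bar z u^{j+m} with k ≥ 2, the pure terms of g drop out and \bar f L
has z-exponent at most 1. What remains is a nonzero multiple of \bar a f_{kj}, and an exponent not
admitted for F gives one not admitted in `Kset`. -/
theorem badF_eq_zero (hA : badH A.m N A = 0) (hA' : badH A.m N A' = 0) : badF A.m N F = 0 := by
  have hm := A.one_le_m
  ext d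
  rw [← e2_eta d]
  change coeff _ (badF A.m N F) = 0
  set k := d 0
  set j := d 1
  by_contra hne
  obtain ⟨h1, h3, -⟩ := g.of_badF hne
  have hk := g.two_le_of_badF hne h.F_zero
  have := coeff_eq_zero_of_mem (g.bad_relation_of_eq_zero h h2 hN hA hA') (k := k) (l := 1)
    (n := j + A.m) (by rw [Kset_add_iff]; unfold Kset Tset at *; omega)
  rw [map_sub, map_sub, coeff_C_mul, coeff_X2_pow_mul, coeff_lift, coeff_liftConj,
    if_neg one_ne_zero, if_neg (by omega), coeff_C_mul, crossF, map_add] at this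
  have e1 : coeff (e3 k 1 j) (liftConj (badF A.m N F) * linF F) = 0 :=
    coeff_eq_zero_of_mem (S := fun k _ _ => k ≤ 1)
      (mul_mem_suppIn (liftConj_mem_zero _) (linF_mem F) fun _ _ _ _ _ _ _ _ => by omega) (by omega)
  have e3 : coeff (e3 k 1 j) (lift (badF A.m N F) * linFConj F) =
      conj (coeff (e2 1 0) F) * coeff (e2 k j) (badF A.m N F) := by
    have e : lift (badF A.m N F) * linFConj F =
        C (conj (coeff (e2 1 0) F)) * (X 1 * lift (badF A.m N F)) +
          lift (badF A.m N F) * (C (conj (coeff (e2 0 1) F)) * X 2) := by rw [linFConj]; ring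
    have e4 : coeff (FuchsianInvariance.e3 k 1 j)
        (lift (badF A.m N F) * (C (conj (coeff (e2 0 1) F)) * X 2)) = 0 :=
      coeff_eq_zero_of_mem (S := fun _ l _ => l = 0) (mul_mem_suppIn (lift_mem_zero _)
        (C_mul_mem (X2_mem (S := fun _ l _ => l = 0) rfl) _) fun _ _ _ _ _ _ _ _ => by omega)
        (by omega)
    rw [e, map_add, e4, coeff_C_mul, add_zero]
    have := coeff_X1_mul (lift (badF A.m N F)) k 0 j
    rw [zero_add, coeff_lift, if_pos rfl] at this
    rw [this]
  rw [e1, e3] at this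
  have hc : conj (coeff (e2 1 0) F) ≠ 0 := by simpa using h.coeff_F_ne_zero
  refine mul_ne_zero (mul_ne_zero Complex.I_ne_zero (pow_ne_zero A.m h.coeff_G_ne_zero))
    (mul_ne_zero (ε_ne_zero A') (mul_ne_zero hc hne)) ?_
  linear_combination -this

/-- With f = 0 only g - \bar g is left. Deviations of G have k ≥ 2, so \bar g does not meet the
coefficient of z^k u^j. -/
theorem badG_coeff_eq_zero (hA : badH A.m N A = 0) (hA' : badH A.m N A' = 0) (k j : ℕ) :
    coeff (e2 k j) (badG A.m N G) = 0 := by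
  have hm := A.one_le_m
  by_contra hne
  obtain ⟨h1, h3⟩ := g.of_badG hne
  have hcross : crossF A.m N F = 0 := by
    have hl : lift (badF A.m N F) ∈ SuppIn fun _ _ _ => False := lift_mem fun k j hkj => by
      rw [g.badF_eq_zero h h2 hN hA hA', map_zero] at hkj; exact hkj rfl
    have hl' : liftConj (badF A.m N F) ∈ SuppIn fun _ _ _ => False := liftConj_mem fun k j hkj => by
      rw [g.badF_eq_zero h h2 hN hA hA', map_zero] at hkj; exact hkj rfl
    have hc : crossF A.m N F ∈ SuppIn fun _ _ _ => False :=
      add_mem (mul_mem_suppIn hl (mem_D_zero _) fun _ _ _ _ _ _ h _ => h)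
        (mul_mem_suppIn hl' (mem_D_zero _) fun _ _ _ _ _ _ h _ => h)
    ext d
    rw [← e3_eta d]
    exact coeff_eq_zero_of_mem hc id
  have := g.bad_relation_of_eq_zero h h2 hN hA hA'
  rw [hcross, mul_zero, mul_zero, mul_zero, sub_zero] at this
  have := coeff_eq_zero_of_mem this (k := k) (l := 0) (n := j)
    (by unfold Kset Tset at *; omega)
  rw [map_sub, coeff_lift, coeff_liftConj, if_pos rfl, if_neg (by unfold Tset at h1; omega),
    sub_zero] at this
  exact hne this

/-- Good behaviour of one equation suffices: the homological equation passes it to the other, and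
then to F and G. -/
theorem succ (hor : A.higherTerms ∈ SuppIn (Kset A.m (N + 1) 0) ∨
    A'.higherTerms ∈ SuppIn (Kset A.m (N + 1) 0)) : FuchsianUpTo A A' F G (N + 1) := by
  rw [← badH_eq_zero_iff, ← badH_eq_zero_iff] at hor
  have hA : badH A.m N A = 0 := hor.elim id (g.badH_source_eq_zero h h2 hN)
  have hA' : badH A.m N A' = 0 := hor.elim (g.badH_target_eq_zero h h2 hN) id
  refine ⟨badH_eq_zero_iff.1 hA, badH_eq_zero_iff.1 hA', fun k j hkj => ?_, fun k j hkj => ?_⟩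
  · by_contra hT
    have h1 := coeff_part2 (fun k j => ¬ Tset A.m (N + 1) 1 0 1 k 0 j) F k j
    rw [if_pos hT] at h1
    rw [← h1] at hkj
    change coeff _ (badF A.m N F) ≠ 0 at hkj
    rw [g.badF_eq_zero h h2 hN hA hA', map_zero] at hkj
    exact hkj rfl
  · by_contra hT
    have h1 := coeff_part2 (fun k j => ¬ Tset A.m (N + 1) 1 0 (A.m + 2) k 0 j) (restPart G) k j
    rw [if_pos hT] at h1
    rw [← h1] at hkj
    exact hkj (g.badG_coeff_eq_zero h h2 hN hA hA' k j)

end FuchsianUpTo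

theorem Kset.anti {m N N' e k l n : ℕ} (hN : N' ≤ N) (h : Kset m N e k l n) :
    Kset m N' e k l n := by
  unfold Kset Tset at *; omega

theorem FormalMap.fuchsianUpTo (h : FormalMap A A' F G)
    (hor : A.higherTerms ∈ SuppIn (Kset A.m (2 * A.m + 5) 0) ∨
      A'.higherTerms ∈ SuppIn (Kset A.m (2 * A.m + 5) 0)) :
    ∀ N, N ≤ 2 * A.m + 3 → FuchsianUpTo A A' F G (N + 2) := by
  intro N
  induction N with
  | zero => exact fun _ => h.fuchsianUpTo_two
  | succ N ih =>
    intro hN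
    refine (ih (by omega)).succ h (by omega) (by omega) ?_
    exact hor.imp (fun h' => suppIn_mono h' fun _ _ _ => Kset.anti (by omega))
      (fun h' => suppIn_mono h' fun _ _ _ => Kset.anti (by omega))

/-- Invariance of Fuchsian type under formal maps. -/
theorem FormalMap.isFuchsian_iff (h : FormalMap A A' F G) : A.IsFuchsian ↔ A'.IsFuchsian := by
  rw [FuchsianInvariance.isFuchsian_iff, FuchsianInvariance.isFuchsian_iff, ← h.m_eq]
  exact ⟨fun hA => (h.fuchsianUpTo (Or.inl hA) _ le_rfl).target,
    fun hA => (h.fuchsianUpTo (Or.inr hA) _ le_rfl).source⟩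

end FuchsianInvariance

end

/-! ### From convergent to formal: calculus of asymptotic expansions. -/

noncomputable section

namespace FuchsianInvariance

open MvPowerSeries Filter Asymptotics

/-! ### Asymptotic expansions -/

section Expansion

variable {α : Type*} {σ : Type*} {l : Filter α} {s : α → ℝ} {c : α → σ → ℂ}

/-- `f` has the asymptotic expansion `P` in the coordinates `c`, with errors measured by `s`. -/
def HasExpansion (l : Filter α) (s : α → ℝ) (c : α → σ → ℂ) (f : α → ℂ)
    (P : MvPowerSeries σ ℂ) : Prop :=
  ∀ N : ℕ, ∃ p : MvPolynomial σ ℂ, (∀ d : σ →₀ ℕ, d.degree < N → p.coeff d = coeff d P) ∧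
    (fun a => f a - MvPolynomial.eval (c a) p) =O[l] fun a => s a ^ N

/-- The coordinates tend to zero at least as fast as `s`. -/
structure IsFrame (l : Filter α) (s : α → ℝ) (c : α → σ → ℂ) : Prop where
  tendsto : Tendsto s l (𝓝 0)
  isBigO : ∀ i, (fun a => c a i) =O[l] s

theorem isBigO_pow_of_le (hs : Tendsto s l (𝓝 0)) {m n : ℕ} (h : m ≤ n) :
    (fun a => s a ^ n) =O[l] fun a => s a ^ m := by
  obtain ⟨k, rfl⟩ := Nat.exists_eq_add_of_le h
  have h1 : s =O[l] fun _ => (1 : ℝ) := hs.isBigO_one ℝ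
  simpa [pow_add] using (isBigO_refl (fun a => s a ^ m) l).mul (h1.pow k)

namespace IsFrame

variable (hc : IsFrame l s c)
include hc

/-- A polynomial whose monomials all have degree at least `N` is `O(s ^ N)`. -/
theorem isBigO_eval {p : MvPolynomial σ ℂ} {N : ℕ} (hp : ∀ d, p.coeff d ≠ 0 → N ≤ d.degree) :
    (fun a => MvPolynomial.eval (c a) p) =O[l] fun a => s a ^ N := by
  simp only [MvPolynomial.eval_eq]
  refine IsBigO.fun_sum fun d hd => ?_
  refine IsBigO.trans ?_ (isBigO_pow_of_le hc.tendsto (hp d (MvPolynomial.mem_support_iff.1 hd)))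
  refine IsBigO.const_mul_left ?_ _
  have : (fun a => s a ^ d.degree) = fun a => ∏ i ∈ d.support, s a ^ d i := by
    ext a
    rw [Finsupp.degree_apply, Finset.prod_pow_eq_pow_sum]
  rw [this]
  exact IsBigO.finsetProd fun i _ => (hc.isBigO i).pow (d i)

theorem eval_isBigO_one (p : MvPolynomial σ ℂ) :
    (fun a => MvPolynomial.eval (c a) p) =O[l] fun _ => (1 : ℝ) := by
  simpa using hc.isBigO_eval (p := p) (N := 0) fun _ _ => Nat.zero_le _

end IsFrame

namespace HasExpansion

theorem congr' {f g : α → ℂ} {P : MvPowerSeries σ ℂ} (hf : HasExpansion l s c f P)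
    (hfg : f =ᶠ[l] g) : HasExpansion l s c g P := by
  intro N
  obtain ⟨p, hp, ho⟩ := hf N
  refine ⟨p, hp, ho.congr' ?_ EventuallyEq.rfl⟩
  filter_upwards [hfg] with a ha
  rw [ha]

theorem const (b : ℂ) : HasExpansion l s c (fun _ => b) (C b) := by
  intro N
  refine ⟨MvPolynomial.C b, fun d _ => ?_, ?_⟩
  · rw [← MvPolynomial.coe_C, MvPolynomial.coeff_coe]
  · simpa using isBigO_zero _ _

theorem coord (i : σ) : HasExpansion l s c (fun a => c a i) (X i) := by
  intro N
  refine ⟨MvPolynomial.X i, fun d _ => ?_, ?_⟩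
  · rw [← MvPolynomial.coe_X, MvPolynomial.coeff_coe]
  · simpa using isBigO_zero _ _

theorem add {f g : α → ℂ} {P Q : MvPowerSeries σ ℂ} (hf : HasExpansion l s c f P)
    (hg : HasExpansion l s c g Q) : HasExpansion l s c (fun a => f a + g a) (P + Q) := by
  intro N
  obtain ⟨p, hp, hpo⟩ := hf N
  obtain ⟨q, hq, hqo⟩ := hg N
  refine ⟨p + q, fun d hd => ?_, ?_⟩
  · rw [MvPolynomial.coeff_add, hp d hd, hq d hd, map_add]
  · exact (hpo.add hqo).congr_left fun a => by rw [map_add]; ring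

theorem isBigO_one {f : α → ℂ} {P : MvPowerSeries σ ℂ} (hf : HasExpansion l s c f P)
    (hc : IsFrame l s c) : f =O[l] fun _ => (1 : ℝ) := by
  obtain ⟨p, -, hpo⟩ := hf 0
  simp only [pow_zero] at hpo
  simpa using hpo.add (hc.eval_isBigO_one p)

theorem mul {f g : α → ℂ} {P Q : MvPowerSeries σ ℂ} (hf : HasExpansion l s c f P)
    (hg : HasExpansion l s c g Q) (hc : IsFrame l s c) :
    HasExpansion l s c (fun a => f a * g a) (P * Q) := by
  classical
  intro N
  obtain ⟨p, hp, hpo⟩ := hf N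
  obtain ⟨q, hq, hqo⟩ := hg N
  refine ⟨p * q, fun d hd => ?_, ?_⟩
  · rw [MvPolynomial.coeff_mul, coeff_mul]
    refine Finset.sum_congr rfl fun x hx => ?_
    rw [Finset.HasAntidiagonal.mem_antidiagonal] at hx
    have h : x.1.degree + x.2.degree = d.degree := by rw [← hx, map_add]
    rw [hp _ (by omega), hq _ (by omega)]
  · have h1 := hpo.mul (hg.isBigO_one hc)
    have h2 := (hc.eval_isBigO_one p).mul hqo
    simp only [mul_one, one_mul] at h1 h2
    exact (h1.add h2).congr_left fun a => by rw [map_mul]; ring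

theorem const_mul {f : α → ℂ} {P : MvPowerSeries σ ℂ} (hf : HasExpansion l s c f P)
    (hc : IsFrame l s c) (b : ℂ) : HasExpansion l s c (fun a => b * f a) (C b * P) :=
  (const b).mul hf hc

theorem sub {f g : α → ℂ} {P Q : MvPowerSeries σ ℂ} (hf : HasExpansion l s c f P)
    (hg : HasExpansion l s c g Q) : HasExpansion l s c (fun a => f a - g a) (P - Q) := by
  intro N
  obtain ⟨p, hp, hpo⟩ := hf N
  obtain ⟨q, hq, hqo⟩ := hg N
  refine ⟨p - q, fun d hd => ?_, ?_⟩
  · rw [MvPolynomial.coeff_sub, hp d hd, hq d hd, map_sub]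
  · exact (hpo.sub hqo).congr_left fun a => by rw [map_sub]; ring

theorem isBigO {f : α → ℂ} {P : MvPowerSeries σ ℂ} (hf : HasExpansion l s c f P)
    (hc : IsFrame l s c) (h0 : constantCoeff P = 0) : f =O[l] s := by
  obtain ⟨p, hp, hpo⟩ := hf 1
  have h1 : (fun a => MvPolynomial.eval (c a) p) =O[l] fun a => s a ^ 1 := by
    refine hc.isBigO_eval fun d hd => ?_
    by_contra hlt
    have h0' : d.degree = 0 := by omega
    apply hd
    rw [hp d (by omega), (Finsupp.degree_eq_zero_iff d).1 h0', coeff_zero_eq_constantCoeff_apply, h0]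
  simpa using hpo.add h1

/-- Change of the underlying space. -/
theorem comp_tendsto {β : Type*} {l' : Filter β} {s' : β → ℝ} {f : α → ℂ} {P : MvPowerSeries σ ℂ}
    (hf : HasExpansion l s c f P) {g : β → α} (hg : Tendsto g l' l)
    (hs : (fun b => s (g b)) =O[l'] s') :
    HasExpansion l' s' (fun b => c (g b)) (fun b => f (g b)) P := by
  intro N
  obtain ⟨p, hp, hpo⟩ := hf N
  exact ⟨p, hp, (hpo.comp_tendsto hg).trans (hs.pow N)⟩

end HasExpansion

end Expansion

section Composition

variable {α : Type*} {σ : Type*} {l : Filter α} {s : α → ℝ} {c : α → Fin 3 → ℂ}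

theorem hasExpansion_eval (hc : IsFrame l s c) {y : α → σ → ℂ} {Q : σ → MvPowerSeries (Fin 3) ℂ}
    (hy : ∀ i, HasExpansion l s c (fun a => y a i) (Q i)) (p : MvPolynomial σ ℂ) :
    HasExpansion l s c (fun a => MvPolynomial.eval (y a) p) (MvPolynomial.aeval Q p) := by
  induction p using MvPolynomial.induction_on with
  | C b =>
    simp only [MvPolynomial.eval_C, MvPolynomial.aeval_C]
    exact HasExpansion.const b
  | add p q hp hq => simpa only [map_add] using hp.add hq
  | mul_X p i hp => simpa only [map_mul, MvPolynomial.eval_X, MvPolynomial.aeval_X] using hp.mul (hy i) hc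

theorem degree_e3 (k l n : ℕ) : (e3 k l n).degree = k + l + n := by
  rw [Finsupp.degree_eq_sum, Fin.sum_univ_three]; rfl

theorem prod_mem_D {Q : σ → MvPowerSeries (Fin 3) ℂ} (hQ : ∀ i, Q i ∈ SuppIn (Dset 1))
    (d : σ →₀ ℕ) : (d.prod fun i e => Q i ^ e) ∈ SuppIn (Dset d.degree) := by
  classical
  rw [Finsupp.prod, Finsupp.degree_apply]
  induction d.support using Finset.induction_on with
  | empty => simpa using mem_D_zero _
  | insert i t hi ih =>
    rw [Finset.prod_insert hi, Finset.sum_insert hi]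
    have := pow_mem_D (hQ i) (d i)
    rw [mul_one] at this
    exact mul_mem_D this ih

/-- Asymptotic expansions may be substituted into each other. -/
theorem HasExpansion.comp [Finite σ] (hc : IsFrame l s c) {y : α → σ → ℂ}
    {Q : σ → MvPowerSeries (Fin 3) ℂ} (hQ : ∀ i, Q i ∈ SuppIn (Dset 1))
    (hy : ∀ i, HasExpansion l s c (fun a => y a i) (Q i)) {f : α → ℂ} {P : MvPowerSeries σ ℂ}
    (hf : HasExpansion l s y f P) : HasExpansion l s c f (subst Q P) := by
  intro N
  obtain ⟨p, hp, hpo⟩ := hf N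
  obtain ⟨q, hq, hqo⟩ := hasExpansion_eval hc hy p N
  have hs : HasSubst Q := hasSubst_of_mem hQ
  refine ⟨q, fun d hd => ?_, by simpa using hpo.add hqo⟩
  rw [hq d hd, ← subst_coe, ← e3_eta d]
  refine (coeff_eq_of_sub_mem (S := Dset N) ?_ ?_).symm
  · rw [← subst_sub hs]
    -- `P` and its approximating polynomial differ only in degrees at least N, and substituting
    -- series without constant term does not lower degrees.
    refine subst_mem hs fun e he => mem_D_mono (prod_mem_D hQ e) ?_
    by_contra hlt
    apply he
    rw [map_sub, MvPolynomial.coeff_coe, hp e (by omega), sub_self]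
  · unfold Dset
    rw [← degree_e3, e3_eta]
    omega

end Composition

end FuchsianInvariance

end

/-! ### Uniqueness of expansions, and expansions of analytic functions. -/

noncomputable section

namespace FuchsianInvariance

open MvPowerSeries Filter Asymptotics

/-! ### Uniqueness of expansions on real points -/

/-- The coordinates `z`, `\bar z`, `u` on `ℂ × ℝ`. -/
def realCoord (q : ℂ × ℝ) : Fin 3 → ℂ := ![q.1, conj q.1, (q.2 : ℂ)]

/-- The coordinates `z`, `w` on `ℂ × ℂ`. -/
def complexCoord (x : ℂ × ℂ) : Fin 2 → ℂ := ![x.1, x.2]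

theorem isFrame_realCoord : IsFrame (𝓝 0) (fun q : ℂ × ℝ => ‖q‖) realCoord := by
  refine ⟨by simpa using (continuous_norm (E := ℂ × ℝ)).tendsto 0, fun i => ?_⟩
  refine IsBigO.of_bound 1 (Eventually.of_forall fun q => ?_)
  rw [norm_norm, one_mul]
  fin_cases i
  · exact norm_fst_le q
  · simpa [realCoord] using norm_fst_le q
  · simpa [realCoord] using norm_snd_le q

theorem isFrame_complexCoord : IsFrame (𝓝 0) (fun x : ℂ × ℂ => ‖x‖) complexCoord := by
  refine ⟨by simpa using (continuous_norm (E := ℂ × ℂ)).tendsto 0, fun i => ?_⟩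
  refine IsBigO.of_bound 1 (Eventually.of_forall fun q => ?_)
  rw [norm_norm, one_mul]
  fin_cases i
  · exact norm_fst_le q
  · exact norm_snd_le q

theorem realCoord_smul (t : ℝ) (q : ℂ × ℝ) : realCoord (t • q) = (t : ℂ) • realCoord q := by
  ext i; fin_cases i <;> simp [realCoord]

/-- A polynomial that vanishes on all real points is zero. -/
theorem eq_zero_of_eval_realCoord {p : MvPolynomial (Fin 3) ℂ}
    (h : ∀ q, MvPolynomial.eval (realCoord q) p = 0) : p = 0 := by
  have h1 : ∀ x : Fin 3 → ℂ, MvPolynomial.eval ![x 0 + Complex.I * x 1, x 0 - Complex.I * x 1, x 2] p = 0 := by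
    -- In the variables x, y, u with z = x + iy, \bar z = x - iy, the hypothesis says that the
    -- polynomial vanishes on all real triples, an infinite grid, so it is zero.
    let P : MvPolynomial (Fin 3) ℂ := MvPolynomial.aeval
      ![MvPolynomial.X 0 + MvPolynomial.C Complex.I * MvPolynomial.X 1,
        MvPolynomial.X 0 - MvPolynomial.C Complex.I * MvPolynomial.X 1, MvPolynomial.X 2] p
    have hP : ∀ x : Fin 3 → ℂ, MvPolynomial.eval x P =
        MvPolynomial.eval ![x 0 + Complex.I * x 1, x 0 - Complex.I * x 1, x 2] p := by
      intro x
      rw [← MvPolynomial.coe_aeval_eq_eval, ← MvPolynomial.coe_aeval_eq_eval]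
      simp only [P, RingHom.coe_coe]
      rw [← AlgHom.comp_apply, MvPolynomial.comp_aeval]
      congr 2
      ext i; fin_cases i <;> simp
    have hz : P = 0 := by
      refine MvPolynomial.funext_set (fun _ => Set.range ((↑) : ℝ → ℂ))
        (fun _ => Set.infinite_range_of_injective Complex.ofReal_injective) fun x hx => ?_
      rw [map_zero, hP]
      choose y hy using fun i => hx i (Set.mem_univ i)
      rw [← h (⟨y 0, y 1⟩, y 2)]
      congr 2
      funext i
      rw [← hy 0, ← hy 1, ← hy 2]
      fin_cases i
      · apply Complex.ext <;> simp [realCoord]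
      · apply Complex.ext <;> simp [realCoord]
      · rfl
    intro x
    rw [← hP, hz, map_zero]
  refine MvPolynomial.funext fun x => ?_
  rw [map_zero]
  -- Complex values of x and y solving x + iy = z and x - iy = \bar z for independent z and \bar z.
  rw [← h1 ![(x 0 + x 1) / 2, -Complex.I * (x 0 - x 1) / 2, x 2]]
  congr 2
  funext i
  fin_cases i
  · change x 0 = (x 0 + x 1) / 2 + Complex.I * (-Complex.I * (x 0 - x 1) / 2)
    linear_combination ((x 0 - x 1) / 2) * Complex.I_sq
  · change x 1 = (x 0 + x 1) / 2 - Complex.I * (-Complex.I * (x 0 - x 1) / 2)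
    linear_combination (-(x 0 - x 1) / 2) * Complex.I_sq
  · simp

/-- A homogeneous polynomial of degree `j` that is `O(‖q‖ ^ (j + 1))` is zero. -/
theorem eq_zero_of_isHomogeneous {p : MvPolynomial (Fin 3) ℂ} {j : ℕ} (hp : p.IsHomogeneous j)
    (ho : (fun q => MvPolynomial.eval (realCoord q) p) =O[𝓝 0] fun q : ℂ × ℝ => ‖q‖ ^ (j + 1)) :
    p = 0 := by
  refine eq_zero_of_eval_realCoord fun q => ?_
  obtain ⟨K, hK⟩ := ho.bound
  have hlim : Tendsto (fun t : ℝ => t • q) (𝓝[>] 0) (𝓝 0) := by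
    have : Tendsto (fun t : ℝ => t • q) (𝓝 0) (𝓝 ((0 : ℝ) • q)) :=
      (continuous_id.smul continuous_const).tendsto 0
    rw [zero_smul] at this
    exact this.mono_left nhdsWithin_le_nhds
  -- On the ray tq the polynomial is t^j times its value at q, while the bound is of order t^{j+1}.
  -- Divide by t^j and let t tend to 0.
  have hb : ∀ᶠ t : ℝ in 𝓝[>] 0,
      ‖MvPolynomial.eval (realCoord q) p‖ ≤ K * ‖q‖ ^ (j + 1) * t := by
    filter_upwards [hlim.eventually hK, self_mem_nhdsWithin] with t ht ht0
    have ht0' : 0 < t := ht0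
    have e : MvPolynomial.eval (realCoord (t • q)) p =
        (t : ℂ) ^ j * MvPolynomial.eval (realCoord q) p := by
      rw [realCoord_smul, MvPolynomial.eval_eq, MvPolynomial.eval_eq, Finset.mul_sum]
      refine Finset.sum_congr rfl fun d hd => ?_
      have hd' : d.degree = j := by
        rw [Finsupp.degree_eq_weight_one]
        exact hp (MvPolynomial.mem_support_iff.1 hd)
      simp only [Pi.smul_apply, smul_eq_mul, mul_pow, Finset.prod_mul_distrib]
      rw [Finset.prod_pow_eq_pow_sum, ← Finsupp.degree_apply, hd']
      ring
    rw [e, norm_mul, norm_pow, norm_pow, norm_norm, norm_smul, Complex.norm_real,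
      Real.norm_of_nonneg ht0'.le, mul_pow, pow_succ t j] at ht
    have : t ^ j * ‖MvPolynomial.eval (realCoord q) p‖ ≤ t ^ j * (K * ‖q‖ ^ (j + 1) * t) := by
      nlinarith [ht]
    exact le_of_mul_le_mul_left this (pow_pos ht0' j)
  have hl : Tendsto (fun t : ℝ => K * ‖q‖ ^ (j + 1) * t) (𝓝[>] 0) (𝓝 0) := by
    have : Tendsto (fun t : ℝ => K * ‖q‖ ^ (j + 1) * t) (𝓝 0) (𝓝 (K * ‖q‖ ^ (j + 1) * 0)) :=
      (continuous_const.mul continuous_id).tendsto 0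
    rw [mul_zero] at this
    exact this.mono_left nhdsWithin_le_nhds
  exact norm_le_zero_iff.1 (ge_of_tendsto hl hb)

/-- Strong induction on the degree: once all lower coefficients vanish, the component of degree j is
O(‖q‖^{j+1}), hence zero. -/
theorem HasExpansion.eq_zero {P : MvPowerSeries (Fin 3) ℂ}
    (h : HasExpansion (𝓝 0) (fun q : ℂ × ℝ => ‖q‖) realCoord (fun _ => 0) P) : P = 0 := by
  have key : ∀ j : ℕ, ∀ d : Fin 3 →₀ ℕ, d.degree = j → coeff d P = 0 := by
    intro j
    induction j using Nat.strong_induction_on with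
    | _ j ih =>
      obtain ⟨p, hp, hpo⟩ := h (j + 1)
      have hhigh : ∀ d, (p - MvPolynomial.homogeneousComponent j p).coeff d ≠ 0 →
          j + 1 ≤ d.degree := by
        intro d hd
        rw [MvPolynomial.coeff_sub, MvPolynomial.coeff_homogeneousComponent] at hd
        by_contra hlt
        apply hd
        split_ifs with hdj
        · exact sub_self _
        · rw [hp d (by omega), ih d.degree (by omega) d rfl, sub_zero]
      have h1 := isFrame_realCoord.isBigO_eval hhigh
      have h2 : MvPolynomial.homogeneousComponent j p = 0 := by
        refine eq_zero_of_isHomogeneous (MvPolynomial.homogeneousComponent_isHomogeneous j p) ?_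
        refine (hpo.add h1).neg_left.congr_left fun q => ?_
        rw [map_sub]; ring
      intro d hd
      have := congrArg (MvPolynomial.coeff d) h2
      rwa [MvPolynomial.coeff_homogeneousComponent, if_pos hd, MvPolynomial.coeff_zero,
        hp d (by omega)] at this
  ext d
  exact key _ d rfl

/-! ### Expansions of analytic functions -/

/-- The terms of degree `n` of a power series in two variables. -/
def taylorPart (p : FormalMultilinearSeries ℂ (ℂ × ℂ) ℂ) (n : ℕ) : MvPolynomial (Fin 2) ℂ :=
  ∑ t : Finset (Fin n), MvPolynomial.monomial (e2 t.card (n - t.card))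
    (p n (t.piecewise (fun _ => ((1 : ℂ), (0 : ℂ))) fun _ => ((0 : ℂ), (1 : ℂ))))

theorem degree_e2 (k j : ℕ) : (e2 k j).degree = k + j := by
  rw [Finsupp.degree_eq_sum, Fin.sum_univ_two]; rfl

theorem coeff_taylorPart_eq_zero (p : FormalMultilinearSeries ℂ (ℂ × ℂ) ℂ) {n : ℕ}
    {d : Fin 2 →₀ ℕ} (hd : d.degree ≠ n) : (taylorPart p n).coeff d = 0 := by
  classical
  rw [taylorPart, MvPolynomial.coeff_sum]
  refine Finset.sum_eq_zero fun t _ => ?_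
  rw [MvPolynomial.coeff_monomial, if_neg]
  rintro rfl
  apply hd
  rw [degree_e2]
  have : t.card ≤ n := by simpa using t.card_le_univ
  omega

/-- Expand by multilinearity after writing x as a combination of (1, 0) and (0, 1); the subset t
records the slots filled with (1, 0). -/
theorem eval_taylorPart (p : FormalMultilinearSeries ℂ (ℂ × ℂ) ℂ) (n : ℕ) (x : ℂ × ℂ) :
    MvPolynomial.eval (complexCoord x) (taylorPart p n) = p n fun _ => x := by
  classical
  have hx : (fun _ : Fin n => x) = (fun _ => x.1 • ((1 : ℂ), (0 : ℂ))) +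
      fun _ => x.2 • ((0 : ℂ), (1 : ℂ)) := by
    ext <;> simp
  rw [hx, ContinuousMultilinearMap.map_add_univ, taylorPart, map_sum]
  refine Finset.sum_congr rfl fun t _ => ?_
  have hpw : (t.piecewise (fun _ : Fin n => x.1 • ((1 : ℂ), (0 : ℂ)))
      fun _ => x.2 • ((0 : ℂ), (1 : ℂ))) = fun i => (if i ∈ t then x.1 else x.2) •
      (t.piecewise (fun _ => ((1 : ℂ), (0 : ℂ))) (fun _ => ((0 : ℂ), (1 : ℂ))) i) := by
    funext i
    by_cases hi : i ∈ t <;> simp [hi]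
  rw [hpw, ContinuousMultilinearMap.map_smul_univ, MvPolynomial.eval_monomial, smul_eq_mul,
    mul_comm]
  congr 1
  rw [Finsupp.prod_fintype _ _ (by simp), Fin.prod_univ_two, Finset.prod_ite]
  simp only [Finset.prod_const, complexCoord, e2_zero, e2_one, Matrix.cons_val_zero,
    Matrix.cons_val_one]
  congr 2
  · congr 1; ext i; simp
  · rw [Finset.filter_not, Finset.card_sdiff_of_subset (Finset.filter_subset _ _)]
    simp

/-- The Taylor series of an analytic function of two variables. -/
theorem exists_hasExpansion {f : ℂ × ℂ → ℂ} (hf : AnalyticAt ℂ f 0) :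
    ∃ P : MvPowerSeries (Fin 2) ℂ, HasExpansion (𝓝 0) (fun x : ℂ × ℂ => ‖x‖) complexCoord f P := by
  obtain ⟨p, hp⟩ := hf
  refine ⟨fun d => (taylorPart p d.degree).coeff d, fun N => ⟨∑ n ∈ Finset.range N, taylorPart p n,
    fun d hd => ?_, ?_⟩⟩
  · rw [MvPolynomial.coeff_sum, Finset.sum_eq_single d.degree]
    · rfl
    · intro n _ hn
      exact coeff_taylorPart_eq_zero p hn.symm
    · intro hn
      exact absurd (Finset.mem_range.2 hd) hn
  · refine (hp.isBigO_sub_partialSum_pow N).congr_left fun x => ?_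
    rw [zero_add, map_sum, FormalMultilinearSeries.partialSum]
    congr 1
    exact Finset.sum_congr rfl fun n _ => (eval_taylorPart p n x).symm

/-- The linear part of the expansion is the derivative. -/
theorem HasExpansion.hasFDerivAt {f : ℂ × ℂ → ℂ} {P : MvPowerSeries (Fin 2) ℂ}
    (h : HasExpansion (𝓝 0) (fun x : ℂ × ℂ => ‖x‖) complexCoord f P) :
    HasFDerivAt f (coeff (e2 1 0) P • ContinuousLinearMap.fst ℂ ℂ ℂ +
      coeff (e2 0 1) P • ContinuousLinearMap.snd ℂ ℂ ℂ) 0 := by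
  obtain ⟨p, hp, hpo⟩ := h 2
  set L := coeff (e2 1 0) P • ContinuousLinearMap.fst ℂ ℂ ℂ +
      coeff (e2 0 1) P • ContinuousLinearMap.snd ℂ ℂ ℂ with hL
  let lp : MvPolynomial (Fin 2) ℂ := MvPolynomial.monomial (e2 0 0) (coeff (e2 0 0) P) +
    MvPolynomial.monomial (e2 1 0) (coeff (e2 1 0) P) +
    MvPolynomial.monomial (e2 0 1) (coeff (e2 0 1) P)
  have hlp : ∀ x, MvPolynomial.eval (complexCoord x) lp = coeff (e2 0 0) P + L x := by
    intro x
    simp only [lp, map_add, MvPolynomial.eval_monomial, Finsupp.prod_fintype, pow_zero,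
      implies_true, Fin.prod_univ_two, e2_zero, e2_one, complexCoord, hL]
    simp [mul_comm]
    ring
  have hhigh : ∀ d, (p - lp).coeff d ≠ 0 → 2 ≤ d.degree := by
    classical
    intro d hd
    by_contra hlt
    apply hd
    rw [← e2_eta d, degree_e2] at hlt
    rw [MvPolynomial.coeff_sub, hp d (by rw [← e2_eta d, degree_e2]; omega), ← e2_eta d]
    simp only [lp, MvPolynomial.coeff_add, MvPolynomial.coeff_monomial, e2_inj]
    generalize d 0 = k at *
    generalize d 1 = j at *
    have : (k = 0 ∧ j = 0) ∨ (k = 1 ∧ j = 0) ∨ (k = 0 ∧ j = 1) := by omega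
    rcases this with ⟨rfl, rfl⟩ | ⟨rfl, rfl⟩ | ⟨rfl, rfl⟩ <;> simp
  have h1 := hpo.add (isFrame_complexCoord.isBigO_eval hhigh)
  have h2 : (fun x => f x - (coeff (e2 0 0) P + L x)) =O[𝓝 0] fun x => ‖x - 0‖ ^ 2 := by
    refine h1.congr (fun x => ?_) fun x => by rw [sub_zero]
    rw [map_sub, hlp]; ring
  have h3 := (h2.hasFDerivAt (𝕜 := ℂ) one_lt_two).add (L.hasFDerivAt.const_add (coeff (e2 0 0) P))
  rw [zero_add] at h3
  refine h3.congr_of_eventuallyEq (Eventually.of_forall fun x => ?_)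
  simp

/-! ### Expansions of convergent series -/

/-- Absolute convergence at radius ρ bounds the terms of degree at least N by |c_n| ρ^{|n|}
(‖q‖/ρ)^N, so the tail is O(‖q‖^N). -/
theorem HasExpansion.of_hasSum {P : MvPowerSeries (Fin 3) ℂ} {r : ℂ × ℝ → ℂ}
    (h : ∀ᶠ q in 𝓝 (0 : ℂ × ℝ), HasSum (fun n : Fin 3 →₀ ℕ =>
      coeff n P * q.1 ^ n 0 * (conj q.1) ^ n 1 * (q.2 : ℂ) ^ n 2) (r q)) :
    HasExpansion (𝓝 0) (fun q : ℂ × ℝ => ‖q‖) realCoord r P := by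
  classical
  obtain ⟨δ, hδ, hball⟩ := Metric.eventually_nhds_iff_ball.1 h
  set ρ : ℝ := δ / 2 with hρdef
  have hρ : 0 < ρ := by positivity
  have hnorm : ∀ (q : ℂ × ℝ) (n : Fin 3 →₀ ℕ),
      ‖coeff n P * q.1 ^ n 0 * (conj q.1) ^ n 1 * (q.2 : ℂ) ^ n 2‖ ≤
        ‖coeff n P‖ * ‖q‖ ^ n.degree := by
    intro q n
    rw [norm_mul, norm_mul, norm_mul, norm_pow, norm_pow, norm_pow, RCLike.norm_conj,
      Complex.norm_real, Finsupp.degree_eq_sum, Fin.sum_univ_three, pow_add, pow_add]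
    have h1 := norm_fst_le q
    have h2 := norm_snd_le q
    calc _ = ‖coeff n P‖ * (‖q.1‖ ^ n 0 * ‖q.1‖ ^ n 1 * ‖q.2‖ ^ n 2) := by ring
      _ ≤ _ := by gcongr
  have hsum : Summable fun n : Fin 3 →₀ ℕ => ‖coeff n P‖ * ρ ^ n.degree := by
    -- At this point z, \bar z and u all have modulus ρ, so summability there is summability of
    -- |c_n| ρ^{|n|}.
    have hq : ((ρ : ℂ), ρ) ∈ Metric.ball (0 : ℂ × ℝ) δ := by
      rw [mem_ball_zero_iff, Prod.norm_def, Complex.norm_real, Real.norm_of_nonneg hρ.le, max_self]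
      linarith
    refine (hball _ hq).summable.norm.congr fun n => ?_
    rw [norm_mul, norm_mul, norm_mul, norm_pow, norm_pow, norm_pow, RCLike.norm_conj,
      Complex.norm_real, Real.norm_of_nonneg hρ.le, Finsupp.degree_eq_sum, Fin.sum_univ_three,
      pow_add, pow_add]
    ring
  intro N
  have hfin : {d : Fin 3 →₀ ℕ | d.degree < N}.Finite :=
    (Finsupp.finite_of_degree_le N).subset fun d (hd : d.degree < N) => hd.le
  let T := hfin.toFinset
  refine ⟨∑ d ∈ T, MvPolynomial.monomial d (coeff d P), fun d hd => ?_, ?_⟩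
  · rw [MvPolynomial.coeff_sum]
    simp only [MvPolynomial.coeff_monomial]
    rw [Finset.sum_ite_eq' T d, if_pos]
    simpa [T] using hd
  · refine IsBigO.of_bound ((∑' n : Fin 3 →₀ ℕ, ‖coeff n P‖ * ρ ^ n.degree) / ρ ^ N) ?_
    filter_upwards [Metric.ball_mem_nhds (0 : ℂ × ℝ) hρ] with q hq
    rw [mem_ball_zero_iff] at hq
    have hs := hball q (by rw [mem_ball_zero_iff]; linarith)
    have heval : MvPolynomial.eval (realCoord q) (∑ d ∈ T, MvPolynomial.monomial d (coeff d P)) =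
        ∑ d ∈ T, coeff d P * q.1 ^ d 0 * (conj q.1) ^ d 1 * (q.2 : ℂ) ^ d 2 := by
      rw [map_sum]
      refine Finset.sum_congr rfl fun d _ => ?_
      rw [MvPolynomial.eval_monomial, Finsupp.prod_fintype _ _ (by simp), Fin.prod_univ_three]
      simp only [realCoord, Matrix.cons_val]
      ring
    have htail := (T.hasSum_compl_iff).2 (by rwa [← sub_add_cancel (r q) (∑ d ∈ T, _)] at hs)
    rw [heval, norm_pow, norm_norm]
    have hb : ∀ n : {x // x ∉ T}, ‖coeff n.1 P * q.1 ^ n.1 0 * (conj q.1) ^ n.1 1 *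
        (q.2 : ℂ) ^ n.1 2‖ ≤ (‖coeff n.1 P‖ * ρ ^ n.1.degree) * (‖q‖ / ρ) ^ N := by
      rintro ⟨n, hn⟩
      have hn' : N ≤ n.degree := by simpa [T] using hn
      refine (hnorm q n).trans ?_
      have h1 : ‖q‖ ^ n.degree = ρ ^ n.degree * (‖q‖ / ρ) ^ n.degree := by
        rw [← mul_pow, mul_div_cancel₀ _ hρ.ne']
      have h2 : (‖q‖ / ρ) ^ n.degree ≤ (‖q‖ / ρ) ^ N :=
        pow_le_pow_of_le_one (by positivity) ((div_le_one hρ).2 hq.le) hn'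
      rw [h1, ← mul_assoc]
      gcongr
    have hsub : Summable fun n : {x // x ∉ T} => ‖coeff n.1 P‖ * ρ ^ n.1.degree :=
      hsum.subtype _
    have h3 := tsum_of_norm_bounded (hsub.mul_right ((‖q‖ / ρ) ^ N)).hasSum hb
    rw [htail.tsum_eq, tsum_mul_right] at h3
    refine h3.trans ?_
    have h4 : ∑' n : {x // x ∉ T}, ‖coeff n.1 P‖ * ρ ^ n.1.degree ≤
        ∑' n : Fin 3 →₀ ℕ, ‖coeff n P‖ * ρ ^ n.degree :=
      hsum.tsum_subtype_le _ (fun n => n ∉ T) (fun n => by positivity)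
    rw [div_pow, div_mul_eq_mul_div, mul_div_assoc]
    gcongr

end FuchsianInvariance

end

noncomputable section

namespace FuchsianInvariance

open MvPowerSeries Filter Asymptotics

/-! ### From holomorphic to formal coordinate changes -/

theorem constantCoeff_eq_zero_of_mem_D {f : MvPowerSeries (Fin 3) ℂ} (hf : f ∈ SuppIn (Dset 1)) :
    constantCoeff f = 0 := by
  have := coeff_eq_zero_of_mem hf (k := 0) (l := 0) (n := 0) (by unfold Dset; omega)
  have h0 : e3 0 0 0 = 0 := by ext i; fin_cases i <;> rfl
  rwa [h0, coeff_zero_eq_constantCoeff_apply] at this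

theorem conj_eval {σ : Type*} (y : σ → ℂ) (p : MvPolynomial σ ℂ) :
    conj (MvPolynomial.eval y p) =
      MvPolynomial.eval (fun i => conj (y i)) (MvPolynomial.map (starRingEnd ℂ) p) := by
  induction p using MvPolynomial.induction_on with
  | C b => simp
  | add p q hp hq => simp only [map_add, hp, hq]
  | mul_X p i hp => simp only [map_mul, hp, MvPolynomial.eval_X, MvPolynomial.map_X]

theorem HasExpansion.conj {α σ : Type*} {l : Filter α} {s : α → ℝ} {c : α → σ → ℂ} {f : α → ℂ}
    {P : MvPowerSeries σ ℂ} (h : HasExpansion l s c f P) :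
    HasExpansion l s (fun a i => conj (c a i)) (fun a => conj (f a))
      (MvPowerSeries.map (starRingEnd ℂ) P) := by
  intro N
  obtain ⟨p, hp, hpo⟩ := h N
  refine ⟨MvPolynomial.map (starRingEnd ℂ) p, fun d hd => ?_, ?_⟩
  · rw [MvPolynomial.coeff_map, hp d hd, coeff_map]
  · refine IsBigO.congr_left (f₁ := fun a => (starRingEnd ℂ) (f a - MvPolynomial.eval (c a) p)) ?_
      fun a => ?_
    · exact IsBigO.of_norm_left (hpo.norm_left.congr_left fun a => (RCLike.norm_conj _).symm)
    · rw [map_sub, conj_eval]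

theorem HasExpansion.constantCoeff_eq {f : ℂ × ℂ → ℂ} {P : MvPowerSeries (Fin 2) ℂ}
    (h : HasExpansion (𝓝 0) (fun x : ℂ × ℂ => ‖x‖) complexCoord f P) :
    constantCoeff P = f 0 := by
  obtain ⟨p, hp, hpo⟩ := h 1
  obtain ⟨K, hK⟩ := hpo.bound
  have h0 := hK.self_of_nhds
  beta_reduce at h0
  have hc : complexCoord 0 = 0 := by ext i; fin_cases i <;> rfl
  rw [norm_zero, zero_pow one_ne_zero, norm_zero, mul_zero, norm_le_zero_iff, sub_eq_zero, hc,
    MvPolynomial.eval_zero, MvPolynomial.constantCoeff_eq, hp 0 (by simp),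
    coeff_zero_eq_constantCoeff_apply] at h0
  exact h0.symm

/-- A holomorphic transition map between admissible coordinates induces a formal one. -/
theorem exists_formal {A A' : AdmissibleForm} {M : Set (ℂ × ℂ)} {p : ℂ × ℂ}
    {φ φ' : ℂ × ℂ → ℂ × ℂ} (h : IsAdmissibleCoordinates M p φ A)
    (h' : IsAdmissibleCoordinates M p φ' A') :
    ∃ F G : MvPowerSeries (Fin 2) ℂ, IsFormalCoordinateChange F G ∧ MapsFormally F G A A' := by
  obtain ⟨hφ, hφ0, ⟨e, he⟩, r, hr, hM⟩ := h
  obtain ⟨hφ', hφ0', ⟨e', he'⟩, r', hr', hM'⟩ := h'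
  have hcd : ContDiffAt ℂ (⊤ : WithTop ℕ∞) φ p := hφ.contDiffAt
  have hfd : HasFDerivAt φ (e : ℂ × ℂ →L[ℂ] ℂ × ℂ) p := by
    rw [he]; exact hφ.differentiableAt.hasFDerivAt
  have hfd' : HasFDerivAt φ' (e' : ℂ × ℂ →L[ℂ] ℂ × ℂ) p := by
    rw [he']; exact hφ'.differentiableAt.hasFDerivAt
  have hst := hcd.hasStrictFDerivAt' hfd (by simp)
  set η := hcd.localInverse hfd (by simp) with hη
  have hη0 : η 0 = p := by
    rw [← hφ0]; exact hcd.localInverse_apply_image hfd (by simp)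
  have hηa : AnalyticAt ℂ η 0 := by
    have := hcd.to_localInverse hfd (by simp)
    rw [hφ0] at this
    exact this.analyticAt
  have hηr : ∀ᶠ y in 𝓝 (0 : ℂ × ℂ), φ (η y) = y := by
    have := hst.eventually_right_inverse
    rwa [hφ0] at this
  have hηd : HasFDerivAt η (e.symm : ℂ × ℂ →L[ℂ] ℂ × ℂ) 0 := by
    have := hst.to_localInverse.hasFDerivAt
    rwa [hφ0] at this
  set ψ : ℂ × ℂ → ℂ × ℂ := fun x => φ' (η x) with hψ
  have hψ0 : ψ 0 = 0 := by rw [hψ]; simp only [hη0, hφ0']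
  have hψa : AnalyticAt ℂ ψ 0 := by
    refine AnalyticAt.fun_comp ?_ hηa
    rwa [hη0]
  have hψd : HasFDerivAt ψ ((e' : ℂ × ℂ →L[ℂ] ℂ × ℂ).comp (e.symm : ℂ × ℂ →L[ℂ] ℂ × ℂ)) 0 := by
    refine HasFDerivAt.comp (g := φ') 0 ?_ hηd
    rwa [hη0]
  obtain ⟨F, hF⟩ := exists_hasExpansion (f := fun x => (ψ x).1) (analyticAt_fst.fun_comp hψa)
  obtain ⟨G, hG⟩ := exists_hasExpansion (f := fun x => (ψ x).2) (analyticAt_snd.fun_comp hψa)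
  have hF0 : constantCoeff F = 0 := by rw [hF.constantCoeff_eq, hψ0]; rfl
  have hG0 : constantCoeff G = 0 := by rw [hG.constantCoeff_eq, hψ0]; rfl
  refine ⟨F, G, ⟨hF0, hG0, ?_⟩, ?_⟩
  · rw [← e2_one_zero, ← e2_zero_one]
    intro hdet
    have h1 := hF.hasFDerivAt.unique hψd.fst
    have h2 := hG.hasFDerivAt.unique hψd.snd
    have hD : ∀ v : ℂ × ℂ, e' (e.symm v) = (coeff (e2 1 0) F * v.1 + coeff (e2 0 1) F * v.2,
        coeff (e2 1 0) G * v.1 + coeff (e2 0 1) G * v.2) := by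
      intro v
      have h1v := DFunLike.congr_fun h1 v
      have h2v := DFunLike.congr_fun h2 v
      simp at h1v h2v
      exact Prod.ext h1v.symm h2v.symm
    have hinj : ∀ v : ℂ × ℂ, e' (e.symm v) = 0 → v = 0 := by
      intro v hv
      simpa using hv
    -- If the determinant vanished, these two vectors built from the rows would lie in the kernel of
    -- the injective derivative. Then all four entries vanish, and (1, 0) lies in the kernel as
    -- well.
    have a1 := hinj (coeff (e2 0 1) G, -coeff (e2 1 0) G) (by
      rw [hD]; ext
      · simp only [Prod.fst_zero]; linear_combination hdet
      · simp only [Prod.snd_zero]; ring)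
    have a2 := hinj (coeff (e2 0 1) F, -coeff (e2 1 0) F) (by
      rw [hD]; ext
      · simp only [Prod.fst_zero]; ring
      · simp only [Prod.snd_zero]; linear_combination -hdet)
    rw [Prod.mk_eq_zero, neg_eq_zero] at a1 a2
    have a3 := hinj (1, 0) (by rw [hD, a1.1, a1.2, a2.1, a2.2]; simp)
    simp at a3
  -- expansions along the hypersurface
  have hfr := isFrame_realCoord
  have hrE : HasExpansion (𝓝 0) (fun q : ℂ × ℝ => ‖q‖) realCoord (fun q => (r q : ℂ))
      A.definingSeries := HasExpansion.of_hasSum hr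
  have hrE' : HasExpansion (𝓝 0) (fun q : ℂ × ℝ => ‖q‖) realCoord (fun q => (r' q : ℂ))
      A'.definingSeries := HasExpansion.of_hasSum hr'
  have hz : HasExpansion (𝓝 0) (fun q : ℂ × ℝ => ‖q‖) realCoord (fun q => q.1) (X 0) :=
    HasExpansion.coord 0
  have hzc : HasExpansion (𝓝 0) (fun q : ℂ × ℝ => ‖q‖) realCoord (fun q => conj q.1) (X 1) :=
    HasExpansion.coord 1
  have hu : HasExpansion (𝓝 0) (fun q : ℂ × ℝ => ‖q‖) realCoord (fun q => (q.2 : ℂ)) (X 2) :=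
    HasExpansion.coord 2
  set w : ℂ × ℝ → ℂ := fun q => q.2 + Complex.I * r q with hwdef
  have hw : HasExpansion (𝓝 0) (fun q : ℂ × ℝ => ‖q‖) realCoord w A.wSeries :=
    hu.add (hrE.const_mul hfr _)
  have hwc : HasExpansion (𝓝 0) (fun q : ℂ × ℝ => ‖q‖) realCoord (fun q => conj (w q))
      A.wConjSeries :=
    (hu.sub (hrE.const_mul hfr _)).congr' (Eventually.of_forall fun q => by
      simp [hwdef]; ring)
  -- Parametrization of the hypersurface in the first coordinates by (z, u).
  set x : ℂ × ℝ → ℂ × ℂ := fun q => (q.1, w q) with hx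
  have hwD := D_of_sub_X2_mem (wSeries_sub_mem A)
  have hwcD := D_of_sub_X2_mem (wConjSeries_sub_mem A)
  have hxO : x =O[𝓝 0] fun q : ℂ × ℝ => ‖q‖ :=
    (hfr.isBigO 0).prod_left (hw.isBigO hfr (constantCoeff_eq_zero_of_mem_D hwD))
  have hxt : Tendsto x (𝓝 0) (𝓝 0) := hxO.trans_tendsto hfr.tendsto
  have pull : ∀ {f : ℂ × ℂ → ℂ} {P : MvPowerSeries (Fin 2) ℂ},
      HasExpansion (𝓝 0) (fun x : ℂ × ℂ => ‖x‖) complexCoord f P →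
      HasExpansion (𝓝 0) (fun q : ℂ × ℝ => ‖q‖) realCoord (fun q => f (x q)) (A.pullback P) ∧
      HasExpansion (𝓝 0) (fun q : ℂ × ℝ => ‖q‖) realCoord (fun q => conj (f (x q)))
        (A.pullbackConj P) := by
    intro f P hfP
    have h1 := hfP.comp_tendsto hxt hxO.norm_left
    exact ⟨HasExpansion.comp hfr (Fin.forall_fin_two.2 ⟨X0_mem_D, hwD⟩)
      (Fin.forall_fin_two.2 ⟨hz, hw⟩) h1, HasExpansion.comp hfr
      (Fin.forall_fin_two.2 ⟨X1_mem_D, hwcD⟩) (Fin.forall_fin_two.2 ⟨hzc, hwc⟩) h1.conj⟩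
  obtain ⟨hFp, hFc⟩ := pull hF
  obtain ⟨hGp, hGc⟩ := pull hG
  have hF00 : coeff (e2 0 0) F = 0 := by rwa [e2_zero_zero, coeff_zero_eq_constantCoeff_apply]
  have hG00 : coeff (e2 0 0) G = 0 := by rwa [e2_zero_zero, coeff_zero_eq_constantCoeff_apply]
  have hRe : HasExpansion (𝓝 0) (fun q : ℂ × ℝ => ‖q‖) realCoord
      (fun q => (((ψ (x q)).2.re : ℝ) : ℂ)) (rePullback A G) :=
    ((hGp.add hGc).const_mul hfr (1 / 2)).congr' (Eventually.of_forall fun q => by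
      beta_reduce
      rw [Complex.re_eq_add_conj]; ring)
  have hyD : ∀ i, (![A.pullback F, A.pullbackConj F, rePullback A G] : Fin 3 → _) i ∈
      SuppIn (Dset 1) := by
    intro i
    fin_cases i
    exacts [pullback_mem_D A hF00, pullbackConj_mem_D A hF00, rePullback_mem_D A hG00]
  set y : ℂ × ℝ → ℂ × ℝ := fun q => ((ψ (x q)).1, (ψ (x q)).2.re) with hy
  have hReO : (fun q => (ψ (x q)).2.re) =O[𝓝 0] fun q : ℂ × ℝ => ‖q‖ := by
    refine IsBigO.of_norm_left ((hRe.isBigO hfr (constantCoeff_eq_zero_of_mem_D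
      (hyD 2))).norm_left.congr_left fun q => Complex.norm_real _)
  have hyO : y =O[𝓝 0] fun q : ℂ × ℝ => ‖q‖ :=
    (hFp.isBigO hfr (constantCoeff_eq_zero_of_mem_D (hyD 0))).prod_left hReO
  have hyt : Tendsto y (𝓝 0) (𝓝 0) := hyO.trans_tendsto hfr.tendsto
  have hrhs : HasExpansion (𝓝 0) (fun q : ℂ × ℝ => ‖q‖) realCoord (fun q => (r' (y q) : ℂ))
      (subst ![A.pullback F, A.pullbackConj F, rePullback A G] A'.definingSeries) := by
    refine HasExpansion.comp hfr hyD (fun i => ?_) (hrE'.comp_tendsto hyt hyO.norm_left)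
    fin_cases i
    exacts [hFp, hFc, hRe]
  have hlhs := ((hGp.sub hGc).const_mul hfr (1 / (2 * Complex.I))).sub hrhs
  have hzero := hlhs.congr' (g := fun _ => 0) (by
    have hηt : Tendsto (fun q => η (x q)) (𝓝 0) (𝓝 p) := by
      have := hηa.continuousAt.tendsto
      rw [hη0] at this
      exact this.comp hxt
    -- The point with first coordinates x(q) satisfies the first equation, hence lies in `M`, hence
    -- satisfies the second equation in the other coordinates.
    filter_upwards [hxt.eventually hηr, hηt.eventually hM, hηt.eventually hM'] with q h1 h2 h3
    have hmem : η (x q) ∈ M := by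
      rw [h2, h1]
      simp [hx, hwdef]
    have h4 : (ψ (x q)).2.im = r' (y q) := h3.1 hmem
    rw [← h4, Complex.im_eq_sub_conj]
    ring)
  exact sub_eq_zero.1 hzero.eq_zero

end FuchsianInvariance

end

theorem mainTheorem9 (A A' : AdmissibleForm) :
    (∀ F G : MvPowerSeries (Fin 2) ℂ, IsFormalCoordinateChange F G → MapsFormally F G A A' →
      (A.IsFuchsian ↔ A'.IsFuchsian)) ∧
    (∀ (M : Set (ℂ × ℂ)) (p : ℂ × ℂ) (φ φ' : ℂ × ℂ → ℂ × ℂ),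
      IsAdmissibleCoordinates M p φ A → IsAdmissibleCoordinates M p φ' A' →
      (A.IsFuchsian ↔ A'.IsFuchsian)) := by
  refine ⟨fun F G h h' => (FuchsianInvariance.FormalMap.of_mapsFormally h h').isFuchsian_iff,
    fun M p φ φ' h h' => ?_⟩
  obtain ⟨F, G, hFG, hmap⟩ := FuchsianInvariance.exists_formal h h'
  exact (FuchsianInvariance.FormalMap.of_mapsFormally hFG hmap).isFuchsian_iff
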